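/- **Setting.** Let $E=\{1,\dots,M\}$ be a set of base arms and $A_0$ a set of at most $K$ further arms, disjoint from $E$ (the conservative action). The feasible actions are $\Theta^K=\{A_0\}\cup\{A\subseteq E:|A|\le K\}$. In round $t=1,\dots,T$ the learner sees feature vectors $x_{t,e}\in\mathbb R^d$ with $\|x_{t,e}\|_2^2\le L$ for all arms $e\in E\cup A_0$, plays an action $A_t\in\Theta^K$ and may observe the weights $w_{t,e}=\theta_*^{\mathsf T}x_{t,e}+\epsilon_{t,e}$, $e\in A_t$, where $\|\theta_*\|_2\le S$. Conditionally on the past and on the features of round $t$, the noise vector is 1-sub-Gaussian: $\mathbb E[\exp(\sum_e c_e\epsilon_{t,e})\mid\cdot\,]\le\exp(\tfrac12\sum_e c_e^2)$ for all real $c_e$ (e.g. the $\epsilon_{t,e}$ are conditionally independent over $e$ and each is conditionally 1-sub-Gaussian). Write $w^*_{t,e}=\theta_*^{\mathsf T}x_{t,e}$. The reward $f(A,w)$ of an action depends only on $(w_e)_{e\in A}$, is non-decreasing and $P$-Lipschitz in these coordinates for the Euclidean norm, and is nonnegative when all of them are nonnegative; moreover $f(A,w^*_t)\ge 0$ for all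 $A\in\Theta^K$. The conservative reward $\mu_0=f(A_0,w^*_t)>0$ does not depend on $t$ and is known. With $A^*_t\in\operatorname{argmax}_{A\in\Theta^K}f(A,w_t^*)$ we have $\Delta_{\min}\le f(A^*_t,w^*_t)-\mu_0\le\Delta_{\max}$ and $\alpha\mu_0+\Delta_{\min}>0$, where $\alpha\in(0,1)$. The pseudo-regret is $R(T)=\sum_{t=1}^T[f(A^*_t,w^*_t)-f(A_t,w^*_t)]$. **Algorithm (CCConUCB, conservative reward known).** Let $\lambda>0$ and $\delta\in(0,1)$. Let $N_t$ and $D_t$ be the sets of rounds $s\le t$ in which the optimistic, respectively the conservative, branch below is taken. Put $V_t=\lambda I+\sum_{n\in N_t}\sum_{e\in A_n}x_{n,e}x_{n,e}^{\mathsf T}$, $\hat\theta_t=V_t^{-1}\sum_{n\in N_t}\sum_{e\in A_n}w_{n,e}x_{n,e}$, $H_t=\sqrt\lambda S+\sqrt{\log(\det V_t/(\lambda^d\delta^2))}$, $U_{t,s,e}=\hat\theta_{t-1}^{\mathsf T}x_{s,e}+H_{t-1}\|x_{s,e}\|_{V_{t-1}^{-1}}$ and $L_{t,s,e}=\max\{0,\hat\theta_{t-1}^{\mathsf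 T}x_{s,e}-H_{t-1}\|x_{s,e}\|_{V_{t-1}^{-1}}\}$; in round $t$ set $f(A_0,U_{t,t})=f(A_0,L_{t,t})=\mu_0$. In round $t$ let $B_t=A_0$ if $\mu_0>\max_{A\in\Theta^K\setminus\{A_0\}}f(A,U_{t,t})$, and otherwise let $B_t$ be a maximizer of $f(A,U_{t,t})$ over $\Theta^K\setminus\{A_0\}$. If $$\sum_{n\in N_{t-1}}f(A_n,L_{t,n})+f(B_t,L_{t,t})+|D_{t-1}|\mu_0\ \ge\ (1-\alpha)t\mu_0,$$ play $A_t=B_t$ (optimistic branch); otherwise play $A_t=A_0$ (conservative branch). Ties between maximizers are broken in any way that uses only the information available before the weights of round $t$ are drawn. **Theorem 1.** Suppose $\lambda\ge L$. There is a constant $c>0$ that depends only on $\alpha,\mu_0,\lambda,L,S,P,\delta,\Delta_{\min},\Delta_{\max}$ such that, for all $d,K,T\ge1$ and every instance as above, with probability at least $1-\delta$ $$R(T)\le c\Big(d\,(d+\sqrt T)\max\{1,\log(TK/d)\}+\frac dK\Big),$$ and moreover, on the same event, if $TK\le d$ then $$R(T)\le c\Big(d\sqrt T+\frac{d^{3/2}}{\sqrt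 K}\Big).$$ -/

import Mathlib

open MeasureTheory Finset
open scoped Matrix

universe u

noncomputable section

namespace CCB

/-- The base arms: `Sum.inl e` for `e ∈ E = {1, …, M}`, and `Sum.inr e` for the `m₀` further arms
that make up the conservative action. -/
abbrev Arm (M m₀ : ℕ) : Type := Fin M ⊕ Fin m₀

/-- The set `E` of ordinary base arms. -/
def baseArms (M m₀ : ℕ) : Finset (Arm M m₀) := univ.filter (fun e => e.isLeft = true)

/-- The conservative action `A₀`. -/
def conservative (M m₀ : ℕ) : Finset (Arm M m₀) := univ.filter (fun e => e.isRight = true)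

/-- The feasible actions other than `A₀`: the sets of at most `K` arms of `E`. -/
def alternatives (M m₀ K : ℕ) : Finset (Finset (Arm M m₀)) :=
  ((baseArms M m₀).powerset.filter (fun A => A.card ≤ K)).erase (conservative M m₀)

/-- The set of feasible actions, `{A₀} ∪ {A ⊆ E : |A| ≤ K}`. -/
def feasible (M m₀ K : ℕ) : Finset (Finset (Arm M m₀)) :=
  insert (conservative M m₀) (alternatives M m₀ K)

/-- `f A w` is the reward of the action `A` under the weights `w`. It depends on `w` only through
the coordinates in `A`; it is non-decreasing and `P`-Lipschitz for the Euclidean norm in these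
coordinates, and it is nonnegative on nonnegative weights. -/
structure IsReward {M m₀ : ℕ} (K : ℕ) (P : ℝ)
    (f : Finset (Arm M m₀) → (Arm M m₀ → ℝ) → ℝ) : Prop where
  mono : ∀ A ∈ feasible M m₀ K, ∀ w v : Arm M m₀ → ℝ,
    (∀ e ∈ A, w e ≤ v e) → f A w ≤ f A v
  lipschitz : ∀ A ∈ feasible M m₀ K, ∀ w v : Arm M m₀ → ℝ,
    |f A w - f A v| ≤ P * Real.sqrt (∑ e ∈ A, (w e - v e) ^ 2)
  nonneg : ∀ A ∈ feasible M m₀ K, ∀ w : Arm M m₀ → ℝ, (∀ e ∈ A, 0 ≤ w e) → 0 ≤ f A w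

/-- The expected weight `w*_e = θ*ᵀ x_e` of every arm, from the feature vectors of one round. -/
def meanWeight {d M m₀ : ℕ} (θ : EuclideanSpace ℝ (Fin d))
    (x : Arm M m₀ → EuclideanSpace ℝ (Fin d)) (e : Arm M m₀) : ℝ :=
  inner ℝ θ (x e)

/-- The value `max_{A ∈ Θ^K} f(A, w)` of an optimal feasible action. -/
def bestValue {M m₀ : ℕ} (K : ℕ) (f : Finset (Arm M m₀) → (Arm M m₀ → ℝ) → ℝ)
    (w : Arm M m₀ → ℝ) : ℝ :=
  (feasible M m₀ K).sup' ⟨conservative M m₀, mem_insert_self _ _⟩ (fun A => f A w)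

/-- Everything that occurs along one realization, round by round (rounds are numbered from 1):
the features, the weights, the optimistic candidate `B`, the played action `A`, and the set `N` of
the rounds in which the optimistic branch is taken. -/
structure Trajectory (d M m₀ : ℕ) where
  x : ℕ → Arm M m₀ → EuclideanSpace ℝ (Fin d)
  w : ℕ → Arm M m₀ → ℝ
  B : ℕ → Finset (Arm M m₀)
  A : ℕ → Finset (Arm M m₀)
  N : Finset ℕ

namespace Trajectory

variable {d M m₀ : ℕ}

/-- `N_t`, the optimistic rounds up to time `t`. -/
def optRounds (τ : Trajectory d M m₀) (t : ℕ) : Finset ℕ := τ.N.filter (fun n => n ≤ t)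

/-- `D_t`, the conservative rounds up to time `t`. -/
def consRounds (τ : Trajectory d M m₀) (t : ℕ) : Finset ℕ := Icc 1 t \ τ.N

/-- `V_t = lam I + ∑_{n ∈ N_t} ∑_{e ∈ A_n} x_{n,e} x_{n,e}ᵀ`. -/
def V (τ : Trajectory d M m₀) (lam : ℝ) (t : ℕ) : Matrix (Fin d) (Fin d) ℝ :=
  lam • (1 : Matrix (Fin d) (Fin d) ℝ) +
    ∑ n ∈ τ.optRounds t, ∑ e ∈ τ.A n, Matrix.vecMulVec (τ.x n e).ofLp (τ.x n e).ofLp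

/-- `Y_t = ∑_{n ∈ N_t} ∑_{e ∈ A_n} w_{n,e} x_{n,e}`; only the weights of the arms played in
optimistic rounds are used. -/
def Y (τ : Trajectory d M m₀) (t : ℕ) : Fin d → ℝ :=
  ∑ n ∈ τ.optRounds t, ∑ e ∈ τ.A n, τ.w n e • (τ.x n e).ofLp

/-- The ridge estimate `V_t⁻¹ Y_t`. -/
def thetaHat (τ : Trajectory d M m₀) (lam : ℝ) (t : ℕ) : Fin d → ℝ :=
  (τ.V lam t)⁻¹ *ᵥ τ.Y t

/-- The confidence radius `H_t = √lam S + √(log (det V_t / (lam ^ d δ²)))`. -/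
def H (τ : Trajectory d M m₀) (lam S δ : ℝ) (t : ℕ) : ℝ :=
  Real.sqrt lam * S + Real.sqrt (Real.log ((τ.V lam t).det / (lam ^ d * δ ^ 2)))

/-- `‖x_{s,e}‖` in the norm of `V_t⁻¹`. -/
def width (τ : Trajectory d M m₀) (lam : ℝ) (t s : ℕ) (e : Arm M m₀) : ℝ :=
  Real.sqrt ((τ.x s e).ofLp ⬝ᵥ ((τ.V lam t)⁻¹ *ᵥ (τ.x s e).ofLp))

/-- The upper confidence bound `U_{t,s,e}`, formed in round `t` from the data up to `t - 1`. -/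
def U (τ : Trajectory d M m₀) (lam S δ : ℝ) (t s : ℕ) (e : Arm M m₀) : ℝ :=
  τ.thetaHat lam (t - 1) ⬝ᵥ (τ.x s e).ofLp + τ.H lam S δ (t - 1) * τ.width lam (t - 1) s e

/-- The lower confidence bound `L_{t,s,e}`, formed in round `t` from the data up to `t - 1`. -/
def Lo (τ : Trajectory d M m₀) (lam S δ : ℝ) (t s : ℕ) (e : Arm M m₀) : ℝ :=
  max 0
    (τ.thetaHat lam (t - 1) ⬝ᵥ (τ.x s e).ofLp - τ.H lam S δ (t - 1) * τ.width lam (t - 1) s e)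

/-- The value that round `t` assigns to `f(B_t, L_{t,t})`; it is `μ₀` for the conservative
action. -/
def candidateLower (τ : Trajectory d M m₀) (f : Finset (Arm M m₀) → (Arm M m₀ → ℝ) → ℝ)
    (μ₀ lam S δ : ℝ) (t : ℕ) : ℝ :=
  if τ.B t = conservative M m₀ then μ₀ else f (τ.B t) (τ.Lo lam S δ t t)

/-- `ψ_t`, the lower bound on the cumulative reward if `B_t` is played in round `t`. -/
def psi (τ : Trajectory d M m₀) (f : Finset (Arm M m₀) → (Arm M m₀ → ℝ) → ℝ)
    (μ₀ lam S δ : ℝ) (t : ℕ) : ℝ :=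
  ∑ n ∈ τ.optRounds (t - 1), f (τ.A n) (τ.Lo lam S δ t n)
    + τ.candidateLower f μ₀ lam S δ t + ((τ.consRounds (t - 1)).card : ℝ) * μ₀

/-- The trajectory is a `T`-round run of CCConUCB with known conservative reward `μ₀`
(ties among maximizers are broken in any way). -/
structure IsRun (τ : Trajectory d M m₀) (K T : ℕ)
    (f : Finset (Arm M m₀) → (Arm M m₀ → ℝ) → ℝ) (α μ₀ lam S δ : ℝ) : Prop where
  opt_subset : τ.N ⊆ Icc 1 T
  candidate_conservative : ∀ t ∈ Icc 1 T,
    (∀ A ∈ alternatives M m₀ K, f A (τ.U lam S δ t t) < μ₀) → τ.B t = conservative M m₀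
  candidate_alternative : ∀ t ∈ Icc 1 T,
    ¬ (∀ A ∈ alternatives M m₀ K, f A (τ.U lam S δ t t) < μ₀) →
      τ.B t ∈ alternatives M m₀ K ∧
        ∀ A ∈ alternatives M m₀ K, f A (τ.U lam S δ t t) ≤ f (τ.B t) (τ.U lam S δ t t)
  opt_iff : ∀ t ∈ Icc 1 T, (t ∈ τ.N ↔ (1 - α) * t * μ₀ ≤ τ.psi f μ₀ lam S δ t)
  play_opt : ∀ t ∈ Icc 1 T, t ∈ τ.N → τ.A t = τ.B t
  play_cons : ∀ t ∈ Icc 1 T, t ∉ τ.N → τ.A t = conservative M m₀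

/-- The pseudo-regret `R(T) = ∑_{t=1}^T (max_A f(A, w*_t) - f(A_t, w*_t))`. -/
def regret (τ : Trajectory d M m₀) (K T : ℕ) (f : Finset (Arm M m₀) → (Arm M m₀ → ℝ) → ℝ)
    (θ : EuclideanSpace ℝ (Fin d)) : ℝ :=
  ∑ t ∈ Icc 1 T, (bestValue K f (meanWeight θ (τ.x t)) - f (τ.A t) (meanWeight θ (τ.x t)))

end Trajectory

/-- Assumptions on the rewards along one realization, for rounds `1, …, T`: bounded features,
nonnegative expected rewards, a constant reward `μ₀` of the conservative action, and the bounds on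
the gap between the optimal reward and `μ₀`. -/
structure IsAdmissible {d M m₀ : ℕ} (τ : Trajectory d M m₀) (K T : ℕ)
    (f : Finset (Arm M m₀) → (Arm M m₀ → ℝ) → ℝ) (θ : EuclideanSpace ℝ (Fin d))
    (μ₀ L Δmin Δmax : ℝ) : Prop where
  feature_bound : ∀ t ∈ Icc 1 T, ∀ e, ‖τ.x t e‖ ^ 2 ≤ L
  reward_nonneg : ∀ t ∈ Icc 1 T, ∀ A ∈ feasible M m₀ K, 0 ≤ f A (meanWeight θ (τ.x t))
  conservative_reward : ∀ t ∈ Icc 1 T, f (conservative M m₀) (meanWeight θ (τ.x t)) = μ₀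
  gap_lower : ∀ t ∈ Icc 1 T, Δmin ≤ bestValue K f (meanWeight θ (τ.x t)) - μ₀
  gap_upper : ∀ t ∈ Icc 1 T, bestValue K f (meanWeight θ (τ.x t)) - μ₀ ≤ Δmax

/-- The probabilistic assumptions. `ℱ (t - 1)` is the information available when the action of
round `t` is chosen: it contains the earlier weights, the features of round `t`, and the tie-breaking
choice of `B_t`. Conditionally on it, the noise vector of round `t` is 1-sub-Gaussian. -/
structure IsStochasticModel {d M m₀ : ℕ} {Ω : Type u} [MeasurableSpace Ω] (ℙ : Measure Ω)
    (ℱ : Filtration ℕ ‹MeasurableSpace Ω›) (T : ℕ) (θ : EuclideanSpace ℝ (Fin d))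
    (τ : Ω → Trajectory d M m₀) : Prop where
  features_predictable : ∀ t ∈ Icc 1 T, ∀ e, Measurable[ℱ (t - 1)] (fun ω => (τ ω).x t e)
  candidate_predictable : ∀ t ∈ Icc 1 T, ∀ A : Finset (Arm M m₀),
    MeasurableSet[ℱ (t - 1)] {ω | (τ ω).B t = A}
  weights_adapted : ∀ t ∈ Icc 1 T, ∀ e, Measurable[ℱ t] (fun ω => (τ ω).w t e)
  noise_integrable : ∀ t ∈ Icc 1 T, ∀ c : Arm M m₀ → ℝ,
    Integrable (fun ω =>
      Real.exp (∑ e, c e * ((τ ω).w t e - meanWeight θ ((τ ω).x t) e))) ℙ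
  noise_subGaussian : ∀ t ∈ Icc 1 T, ∀ c : Arm M m₀ → ℝ,
    ℙ[fun ω => Real.exp (∑ e, c e * ((τ ω).w t e - meanWeight θ ((τ ω).x t) e)) | ℱ (t - 1)]
      ≤ᵐ[ℙ] fun _ => Real.exp ((∑ e, c e ^ 2) / 2)

end CCB

end

/-! The argument has one probabilistic input; everything after it is deterministic.

Probability. For a fixed direction `y`, `exp (y ⬝ S_t - y ⬝ V_t y / 2)`, with `S_t` the accumulated
noise, is a supermartingale up to the fixed factor that the ridge term contributes. Integrating over
all `y` keeps this property, and the Gaussian integral gives `exp (S_t ⬝ V_t⁻¹ S_t / 2) / √(det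
V_t)` times a constant. Ville's inequality then puts `θ` in every confidence ellipsoid with
probability at least `1 - δ` (`measure_exists_log_det_le`, `le_measure_confidence`). This needs the
set of optimistic rounds to be predictable, which is proved by induction over the rounds
(`measurableSet_mem_opt`).

On that event, let `g_n` be the `energy` of round `n` and `η` a bound on all radii. Optimism bounds
the regret of an optimistic round by `2 |P| η √g_n` (`bestValue_le_add`), and the lower bound
credited to that round at any later time loses at most as much again (`value_le_lower_add`).
Nonnegative rewards and the bounded gap give a constant bound as well, so only `min 1 √g_n` matters.
This cap makes `L ≤ lam` sufficient although a batch of `K` arms may have large energy. A batch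
multiplies the determinant by at least `1 + g_n`, so by Cauchy–Schwarz `Q = ∑ min 1 √g_n` is of
order `√(T d log (1 + T K / d))`.

At a conservative round `t` the safety test fails, although the credited reward is at least `(t - 1)
μ₀ - C Q`; hence `α μ₀ t ≤ μ₀ + C Q` (`conservative_round_le`). Applied to the last such round, this
bounds their number, and each costs at most `|Δmax|`. With `η`, and hence `C`, of order `√(d m)`,
where `m = max 1 (log (T K / d))`, the regret is `O(d √T m)`, which is below both claimed bounds. -/

namespace CCB

/-! ### Quadratic forms, inverses and determinants of positive definite matrices -/

section LinearAlgebra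

variable {ι κ : Type*} [Fintype ι]

lemma dotProduct_mulVec_symm {V : Matrix ι ι ℝ} (hV : V.IsHermitian) (x y : ι → ℝ) :
    x ⬝ᵥ V *ᵥ y = y ⬝ᵥ V *ᵥ x := by
  have h : Vᵀ = V := by simpa [Matrix.IsHermitian] using hV
  rw [dotProduct_comm, Matrix.dotProduct_mulVec, ← Matrix.mulVec_transpose, h]

lemma quadForm_sub {V : Matrix ι ι ℝ} (hV : V.IsHermitian) (x y : ι → ℝ) :
    (x - y) ⬝ᵥ V *ᵥ (x - y) = x ⬝ᵥ V *ᵥ x - 2 * (x ⬝ᵥ V *ᵥ y) + y ⬝ᵥ V *ᵥ y := by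
  simp only [Matrix.mulVec_sub, dotProduct_sub, sub_dotProduct]
  rw [dotProduct_mulVec_symm hV y x]; ring

lemma quadForm_nonneg {V : Matrix ι ι ℝ} (hV : V.PosSemidef) (x : ι → ℝ) :
    0 ≤ x ⬝ᵥ V *ᵥ x := by
  simpa using hV.dotProduct_mulVec_nonneg x

/-- Cauchy–Schwarz for a possibly degenerate form: the polynomial `s ↦ (x - s y) ⬝ V (x - s y)` is
nonnegative, so its discriminant is at most zero. -/
lemma abs_dotProduct_mulVec_le {V : Matrix ι ι ℝ} (hV : V.PosSemidef) (x y : ι → ℝ) :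
    |x ⬝ᵥ V *ᵥ y| ≤ √(x ⬝ᵥ V *ᵥ x) * √(y ⬝ᵥ V *ᵥ y) := by
  rw [← Real.sqrt_mul (quadForm_nonneg hV x)]
  apply Real.abs_le_sqrt
  have h : ∀ s : ℝ, 0 ≤ (y ⬝ᵥ V *ᵥ y) * (s * s) + (-2 * (x ⬝ᵥ V *ᵥ y)) * s + x ⬝ᵥ V *ᵥ x := by
    intro s
    have h1 := quadForm_nonneg hV (x - s • y)
    rw [quadForm_sub hV.1] at h1
    simp only [Matrix.mulVec_smul, dotProduct_smul, smul_dotProduct, smul_eq_mul] at h1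
    linarith
  have := discrim_le_zero h
  rw [discrim] at this
  nlinarith

lemma sqrt_quadForm_sub_le {V : Matrix ι ι ℝ} (hV : V.PosSemidef) (x y : ι → ℝ) :
    √((x - y) ⬝ᵥ V *ᵥ (x - y)) ≤ √(x ⬝ᵥ V *ᵥ x) + √(y ⬝ᵥ V *ᵥ y) := by
  have hx := Real.sq_sqrt (quadForm_nonneg hV x)
  have hy := Real.sq_sqrt (quadForm_nonneg hV y)
  have := neg_le_of_abs_le (abs_dotProduct_mulVec_le hV x y)
  apply Real.sqrt_le_iff.2 ⟨by positivity, ?_⟩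
  rw [quadForm_sub hV.1]
  nlinarith

variable [DecidableEq ι] [Fintype κ] [DecidableEq κ]

lemma mulVec_inv_mulVec {V : Matrix ι ι ℝ} (hV : V.PosDef) (x : ι → ℝ) :
    V *ᵥ (V⁻¹ *ᵥ x) = x := by
  rw [Matrix.mulVec_mulVec, Matrix.mul_nonsing_inv _ ((Matrix.isUnit_iff_isUnit_det _).1 hV.isUnit),
    Matrix.one_mulVec]

lemma inv_mulVec_mulVec {V : Matrix ι ι ℝ} (hV : V.PosDef) (x : ι → ℝ) :
    V⁻¹ *ᵥ (V *ᵥ x) = x := by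
  rw [Matrix.mulVec_mulVec, Matrix.nonsing_inv_mul _ ((Matrix.isUnit_iff_isUnit_det _).1 hV.isUnit),
    Matrix.one_mulVec]

/-- Completing the square; this drives both the Fenchel–Young inequality and the Gaussian integral.
-/
lemma quadForm_inv_sub {V : Matrix ι ι ℝ} (hV : V.PosDef) (x y : ι → ℝ) :
    (y - V⁻¹ *ᵥ x) ⬝ᵥ V *ᵥ (y - V⁻¹ *ᵥ x)
      = y ⬝ᵥ V *ᵥ y - 2 * (y ⬝ᵥ x) + x ⬝ᵥ V⁻¹ *ᵥ x := by
  rw [quadForm_sub hV.1, mulVec_inv_mulVec hV, dotProduct_comm (V⁻¹ *ᵥ x) x]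

/-- The Fenchel–Young inequality for the quadratic form of a positive definite matrix. -/
lemma two_mul_dotProduct_sub_le {V : Matrix ι ι ℝ} (hV : V.PosDef) (x y : ι → ℝ) :
    2 * (y ⬝ᵥ x) - y ⬝ᵥ V *ᵥ y ≤ x ⬝ᵥ V⁻¹ *ᵥ x := by
  have h := quadForm_nonneg hV.posSemidef (y - V⁻¹ *ᵥ x)
  rw [quadForm_inv_sub hV] at h
  linarith

/-- Fenchel–Young for `V`, tested at `W⁻¹ x`, where the corresponding inequality for `W` is an
equality. -/
lemma quadForm_inv_antitone {V W : Matrix ι ι ℝ} (hV : V.PosDef) (hW : W.PosDef)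
    (h : ∀ y : ι → ℝ, y ⬝ᵥ V *ᵥ y ≤ y ⬝ᵥ W *ᵥ y) (x : ι → ℝ) :
    x ⬝ᵥ W⁻¹ *ᵥ x ≤ x ⬝ᵥ V⁻¹ *ᵥ x := by
  have h1 := two_mul_dotProduct_sub_le hV x (W⁻¹ *ᵥ x)
  have h2 := h (W⁻¹ *ᵥ x)
  have h3 := quadForm_inv_sub hW x (W⁻¹ *ᵥ x)
  rw [sub_self, zero_dotProduct] at h3
  linarith

/-- Expanding `∏ (1 + eigenvalue)` with nonnegative eigenvalues leaves at least `1 + ∑ eigenvalue`.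
-/
lemma one_add_trace_le_det_one_add {G : Matrix κ κ ℝ} (hG : G.PosSemidef) :
    1 + G.trace ≤ (1 + G).det := by
  have h1 : (1 + G).det = ∏ i, (1 + hG.1.eigenvalues i) := by
    -- At `-1` the characteristic polynomial is `det (-(1 + G))`; the sign `(-1) ^ card` appears on
    -- both sides and cancels.
    have h := congrArg (Polynomial.eval (-1)) hG.1.charpoly_eq
    rw [Matrix.eval_charpoly, Polynomial.eval_prod] at h
    have e : (Matrix.scalar κ (-1 : ℝ)) - G = -(1 + G) := by
      ext i j
      by_cases hij : i = j
      · simp [hij]; ring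
      · simp [hij]
    have e2 : ∀ i, Polynomial.eval (-1 : ℝ)
        (Polynomial.X - Polynomial.C (RCLike.ofReal (hG.1.eigenvalues i) : ℝ))
          = (-1) * (1 + hG.1.eigenvalues i) := by
      intro i; simp; ring
    rw [e, Matrix.det_neg, Finset.prod_congr rfl (fun i _ => e2 i), Finset.prod_mul_distrib] at h
    simp only [Finset.prod_const, Finset.card_univ] at h
    exact mul_left_cancel₀ (pow_ne_zero _ (by norm_num)) h
  have h2 : G.trace = ∑ i, hG.1.eigenvalues i := by simpa using hG.1.trace_eq_sum_eigenvalues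
  rw [h1, h2]
  have : ∀ s : Finset κ, 1 + ∑ i ∈ s, hG.1.eigenvalues i ≤ ∏ i ∈ s, (1 + hG.1.eigenvalues i) := by
    intro s
    induction s using Finset.induction_on with
    | empty => simp
    | insert a s ha ih =>
      rw [Finset.sum_insert ha, Finset.prod_insert ha]
      have h0 := hG.eigenvalues_nonneg a
      have hs : 0 ≤ ∑ i ∈ s, hG.1.eigenvalues i :=
        Finset.sum_nonneg fun i _ => hG.eigenvalues_nonneg i
      nlinarith
  exact this univ

/-- The determinant grows at least by the factor `1 + ∑ xᵉ ⬝ V⁻¹ xᵉ` under the update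
`V + ∑ xᵉ xᵉᵀ`. -/
lemma det_mul_one_add_sum_le (V : Matrix ι ι ℝ) (hV : V.PosDef) (x : κ → ι → ℝ) (s : Finset κ) :
    V.det * (1 + ∑ e ∈ s, x e ⬝ᵥ V⁻¹ *ᵥ x e)
      ≤ (V + ∑ e ∈ s, Matrix.vecMulVec (x e) (x e)).det := by
  -- Columns outside `s` are set to zero, so the update is `X Xᵀ` with index type `κ` rather than a
  -- subtype.
  let X : Matrix ι κ ℝ := Matrix.of fun i e => if e ∈ s then x e i else 0
  have hX : ∑ e ∈ s, Matrix.vecMulVec (x e) (x e) = X * Xᵀ := by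
    ext i j
    simp [Matrix.sum_apply, Matrix.vecMulVec_apply, Matrix.mul_apply, X]
  have hu := (Matrix.isUnit_iff_isUnit_det _).1 hV.isUnit
  have h1 : V + X * Xᵀ = V * (1 + (V⁻¹ * X) * Xᵀ) := by
    rw [mul_add, mul_one, Matrix.mul_assoc, ← Matrix.mul_assoc V, Matrix.mul_nonsing_inv _ hu,
      Matrix.one_mul]
  have hG : (Xᵀ * (V⁻¹ * X)).PosSemidef := by
    have := (hV.inv.posSemidef).conjTranspose_mul_mul_same X
    rwa [Matrix.conjTranspose_eq_transpose_of_trivial, Matrix.mul_assoc] at this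
  have htr : (Xᵀ * (V⁻¹ * X)).trace = ∑ e ∈ s, x e ⬝ᵥ V⁻¹ *ᵥ x e := by
    have hcol : ∀ e, (Xᵀ * (V⁻¹ * X)) e e = if e ∈ s then x e ⬝ᵥ V⁻¹ *ᵥ x e else 0 := by
      intro e
      by_cases he : e ∈ s
      · simp [Matrix.mul_apply, X, he, dotProduct, Matrix.mulVec]
      · simp [Matrix.mul_apply, X, he]
    simp only [Matrix.trace, Matrix.diag_apply, hcol]
    simp
  -- Sylvester's identity passes to the `κ × κ` matrix `1 + Xᵀ V⁻¹ X`, whose trace carries the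
  -- required sum.
  rw [hX, h1, Matrix.det_mul, Matrix.det_one_add_mul_comm, ← htr]
  exact mul_le_mul_of_nonneg_left (one_add_trace_le_det_one_add hG) hV.det_pos.le

/-- The arithmetic–geometric mean inequality for the eigenvalues. -/
lemma det_le_trace_div_card_pow [Nonempty ι] {V : Matrix ι ι ℝ} (hV : V.PosSemidef) :
    V.det ≤ (V.trace / Fintype.card ι) ^ Fintype.card ι := by
  have h2 : V.trace = ∑ i, hV.1.eigenvalues i := by simpa using hV.1.trace_eq_sum_eigenvalues
  have h1 : V.det = ∏ i, hV.1.eigenvalues i := by simpa using hV.1.det_eq_prod_eigenvalues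
  have hn : (0 : ℝ) < Fintype.card ι := by exact_mod_cast Fintype.card_pos
  have h := Real.geom_mean_le_arith_mean univ (fun _ => (1 : ℝ)) hV.1.eigenvalues
    (fun _ _ => zero_le_one) (by simpa using hn) (fun i _ => hV.eigenvalues_nonneg i)
  simp only [Real.rpow_one, Finset.sum_const, Finset.card_univ, nsmul_eq_mul, mul_one,
    one_mul, ← h1, ← h2] at h
  have hdet := hV.det_nonneg
  calc V.det = (V.det ^ ((Fintype.card ι : ℝ)⁻¹)) ^ Fintype.card ι := by
        rw [Real.rpow_inv_natCast_pow hdet Fintype.card_ne_zero]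
    _ ≤ _ := by gcongr

end LinearAlgebra

/-! ### The Gaussian integral -/

section Gaussian

variable {ι : Type*} [Fintype ι]

/-- The integral of the unnormalized standard Gaussian density. -/
noncomputable def gaussianMass (ι : Type*) [Fintype ι] : ENNReal :=
  ∫⁻ y : ι → ℝ, ENNReal.ofReal (Real.exp (-(y ⬝ᵥ y) / 2))

/-- The exact value is never needed: the mass occurs on both sides of the maximal inequality and
cancels, being finite and nonzero. -/
lemma gaussianMass_ne_top : gaussianMass ι ≠ ⊤ := by
  have h : Integrable (fun y : ι → ℝ => ∏ i, Real.exp (-(1 / 2) * (y i) ^ 2)) :=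
    Integrable.fintype_prod (fun _ => integrable_exp_neg_mul_sq (by norm_num))
  have e : (fun y : ι → ℝ => ∏ i, Real.exp (-(1 / 2) * (y i) ^ 2))
      = fun y => Real.exp (-(y ⬝ᵥ y) / 2) := by
    funext y
    rw [← Real.exp_sum, ← Finset.mul_sum, dotProduct]
    congr 1
    rw [neg_div, div_eq_inv_mul, ← neg_mul]
    simp only [pow_two]; ring
  rw [e] at h
  exact h.lintegral_lt_top.ne

lemma gaussianMass_ne_zero : gaussianMass ι ≠ 0 := by
  unfold gaussianMass
  rw [ne_eq, lintegral_eq_zero_iff' (by unfold dotProduct; fun_prop)]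
  intro h
  have h' : ∀ᵐ y : ι → ℝ, False := by
    filter_upwards [h] with y hy
    have : (0 : ENNReal) < ENNReal.ofReal (Real.exp (-(y ⬝ᵥ y) / 2)) := by simp [Real.exp_pos]
    exact this.ne' hy
  simp only [Filter.eventually_false_iff_eq_bot, ae_eq_bot] at h'
  exact NeZero.ne _ h'

/-- The multivariate Gaussian integral. -/
lemma lintegral_exp_quadForm [DecidableEq ι] {V : Matrix ι ι ℝ} (hV : V.PosDef) (x : ι → ℝ) :
    ∫⁻ y : ι → ℝ, ENNReal.ofReal (Real.exp (y ⬝ᵥ x - (y ⬝ᵥ V *ᵥ y) / 2))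
      = ENNReal.ofReal (Real.exp ((x ⬝ᵥ V⁻¹ *ᵥ x) / 2) * (√V.det)⁻¹) * gaussianMass ι := by
  -- `B` is the positive square root of `V`; the substitution `y ↦ B y` then reduces the form to the
  -- standard one with Jacobian `√(det V)`.
  obtain ⟨B, hB, hdet⟩ : ∃ B : Matrix ι ι ℝ, Bᵀ * B = V ∧ B.det = √V.det := by
    open scoped MatrixOrder in
    have h0 : (0 : Matrix ι ι ℝ) ≤ V := Matrix.nonneg_iff_posSemidef.2 hV.posSemidef
    refine ⟨CFC.sqrt V, ?_, ?_⟩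
    · have : (CFC.sqrt V).IsHermitian := (Matrix.nonneg_iff_posSemidef.1 (CFC.sqrt_nonneg V)).1
      have e : (CFC.sqrt V)ᵀ = CFC.sqrt V := by simpa [Matrix.IsHermitian] using this
      rw [e]; exact CFC.sqrt_mul_sqrt_self V h0
    · simpa using hV.posSemidef.det_sqrt
  have hdet0 : B.det ≠ 0 := by rw [hdet]; exact (Real.sqrt_pos.2 hV.det_pos).ne'
  have hq : ∀ y : ι → ℝ, (B *ᵥ y) ⬝ᵥ (B *ᵥ y) = y ⬝ᵥ V *ᵥ y := by
    intro y
    rw [← hB, ← Matrix.mulVec_mulVec, Matrix.dotProduct_mulVec y, Matrix.vecMul_transpose]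
  let g : (ι → ℝ) → ENNReal := fun y => ENNReal.ofReal (Real.exp (-(y ⬝ᵥ y) / 2))
  have hg : Measurable g := by unfold g dotProduct; fun_prop
  have h1 : ∫⁻ y : ι → ℝ, g (B *ᵥ y) = ENNReal.ofReal (√V.det)⁻¹ * gaussianMass ι := by
    have h := Real.map_matrix_volume_pi_eq_smul_volume_pi hdet0
    have h2 : ∫⁻ y, g y ∂(Measure.map (Matrix.toLin' B) volume) = ∫⁻ y : ι → ℝ, g (B *ᵥ y) := by
      rw [lintegral_map hg]
      · simp
      · exact (LinearMap.continuous_of_finiteDimensional _).measurable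
    rw [← h2, h, lintegral_smul_measure, hdet, abs_of_nonneg (by positivity)]
    rfl
  have h3 : ∀ y : ι → ℝ, ENNReal.ofReal (Real.exp (y ⬝ᵥ x - (y ⬝ᵥ V *ᵥ y) / 2))
      = ENNReal.ofReal (Real.exp ((x ⬝ᵥ V⁻¹ *ᵥ x) / 2)) * g (B *ᵥ (y - V⁻¹ *ᵥ x)) := by
    intro y
    simp only [g]
    rw [← ENNReal.ofReal_mul (Real.exp_pos _).le, ← Real.exp_add, hq, quadForm_inv_sub hV]
    congr 2; ring
  simp_rw [h3]
  have hBm : Measurable fun y : ι → ℝ => B *ᵥ y :=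
    (LinearMap.continuous_of_finiteDimensional (Matrix.mulVecLin B)).measurable
  rw [lintegral_const_mul (f := fun y => g (B *ᵥ (y - V⁻¹ *ᵥ x))) _
      (hg.comp (hBm.comp (measurable_id.sub_const _))),
    lintegral_sub_right_eq_self (μ := volume) (fun y => g (B *ᵥ y)) (V⁻¹ *ᵥ x), h1,
    ENNReal.ofReal_mul (Real.exp_pos _).le, mul_assoc]

end Gaussian

/-! ### Conditionally sub-Gaussian vectors with random coefficients -/

section SubGaussian

variable {Ω : Type*} {m mΩ : MeasurableSpace Ω} {μ : Measure Ω} [IsProbabilityMeasure μ]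
  {κ : Type*} [Fintype κ] {ε : Ω → κ → ℝ}

/-- The exponential weight `exp (c ⬝ v - ‖c‖² / 2)`. -/
noncomputable def expWeight (c v : κ → ℝ) : ENNReal :=
  ENNReal.ofReal (Real.exp (∑ e, c e * v e - (∑ e, c e ^ 2) / 2))

lemma measurable_expWeight (hε : ∀ e, Measurable fun ω => ε ω e) {c : Ω → κ → ℝ}
    (hc : ∀ e, Measurable fun ω => c ω e) : Measurable fun ω => expWeight (c ω) (ε ω) := by
  unfold expWeight
  fun_prop

/-- The weight has conditional mean at most one. This is expressed as domination of measures on `m`,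
so that `Z` need not be finite or integrable. -/
lemma lintegral_mul_expWeight_const_le (hm : m ≤ mΩ) (hε : ∀ e, Measurable fun ω => ε ω e)
    (c : κ → ℝ) (hint : Integrable (fun ω => Real.exp (∑ e, c e * ε ω e)) μ)
    (hsub : μ[fun ω => Real.exp (∑ e, c e * ε ω e) | m]
      ≤ᵐ[μ] fun _ => Real.exp ((∑ e, c e ^ 2) / 2))
    {Z : Ω → ENNReal} (hZ : Measurable[m] Z) :
    ∫⁻ ω, Z ω * expWeight c (ε ω) ∂μ ≤ ∫⁻ ω, Z ω ∂μ := by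
  have hg : Measurable fun ω => expWeight c (ε ω) :=
    measurable_expWeight hε fun _ => measurable_const
  have hle : (μ.withDensity fun ω => expWeight c (ε ω)).trim hm ≤ μ.trim hm := by
    refine Measure.le_iff.2 fun s hs => ?_
    rw [trim_measurableSet_eq hm hs, trim_measurableSet_eq hm hs, withDensity_apply _ (hm s hs)]
    have e : ∀ ω, expWeight c (ε ω) = ENNReal.ofReal (Real.exp (-((∑ e, c e ^ 2) / 2)))
        * ENNReal.ofReal (Real.exp (∑ e, c e * ε ω e)) := by
      intro ω
      rw [← ENNReal.ofReal_mul (Real.exp_pos _).le, ← Real.exp_add, expWeight]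
      congr 2; ring
    simp_rw [e]
    rw [lintegral_const_mul _ (by fun_prop), ← ofReal_integral_eq_lintegral_ofReal hint.integrableOn
      (Filter.Eventually.of_forall fun _ => (Real.exp_pos _).le), ← setIntegral_condExp hm hint hs,
      ← ENNReal.ofReal_mul (Real.exp_pos _).le, ← ENNReal.ofReal_toReal (measure_ne_top μ s)]
    apply ENNReal.ofReal_le_ofReal
    have h1 : ∫ ω in s, (μ[fun ω => Real.exp (∑ e, c e * ε ω e) | m]) ω ∂μ
        ≤ ∫ _ in s, Real.exp ((∑ e, c e ^ 2) / 2) ∂μ :=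
      integral_mono_ae integrable_condExp.integrableOn (integrable_const _)
        (ae_restrict_of_ae hsub)
    rw [setIntegral_const, smul_eq_mul, Measure.real] at h1
    calc _ ≤ Real.exp (-((∑ e, c e ^ 2) / 2)) * ((μ s).toReal * Real.exp ((∑ e, c e ^ 2) / 2)) := by
          gcongr
      _ = (μ s).toReal := by
          rw [mul_left_comm, ← Real.exp_add]; simp
  calc ∫⁻ ω, Z ω * expWeight c (ε ω) ∂μ
      = ∫⁻ ω, Z ω ∂(μ.withDensity fun ω => expWeight c (ε ω)) := by
        rw [lintegral_withDensity_eq_lintegral_mul _ hg (hZ.mono hm le_rfl)]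
        simp [mul_comm]
    _ = ∫⁻ ω, Z ω ∂((μ.withDensity fun ω => expWeight c (ε ω)).trim hm) :=
        (lintegral_trim hm hZ).symm
    _ ≤ ∫⁻ ω, Z ω ∂(μ.trim hm) := lintegral_mono' hle le_rfl
    _ = _ := lintegral_trim hm hZ

lemma exists_finite_range_approx {Ω κ : Type*} [MeasurableSpace Ω] [Fintype κ] {c : Ω → κ → ℝ}
    (hc : ∀ e, Measurable fun ω => c ω e) :
    ∃ s : ℕ → Ω → κ → ℝ, (∀ n, (Set.range (s n)).Finite) ∧
      (∀ n v, MeasurableSet (s n ⁻¹' {v})) ∧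
      ∀ ω, Filter.Tendsto (fun n => s n ω) Filter.atTop (nhds (c ω)) := by
  have hcm : Measurable c := measurable_pi_lambda _ hc
  refine ⟨fun n => SimpleFunc.approxOn c hcm Set.univ 0 (Set.mem_univ 0) n,
    fun n => SimpleFunc.finite_range _, fun n v => SimpleFunc.measurableSet_fiber _ _, fun ω => ?_⟩
  exact SimpleFunc.tendsto_approxOn hcm (Set.mem_univ 0) (by simp)

lemma eq_sum_indicator_fiber {Ω β : Type*} {s : Ω → β} (hs : (Set.range s).Finite)
    (g : Ω → ENNReal) (ω : Ω) : g ω = ∑ v ∈ hs.toFinset, (s ⁻¹' {v}).indicator g ω := by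
  rw [Finset.sum_eq_single (s ω)]
  · simp
  · intro v _ hv
    exact Set.indicator_of_notMem (fun h => hv h.symm) _
  · simp

/-- On each fibre of `s` the coefficients are frozen, which reduces random coefficients of finite
range to constant ones. -/
lemma mul_expWeight_eq_sum {Ω κ : Type*} [Fintype κ] {s ε : Ω → κ → ℝ}
    (hs : (Set.range s).Finite) (Z : Ω → ENNReal) (ω : Ω) :
    Z ω * expWeight (s ω) (ε ω)
      = ∑ v ∈ hs.toFinset, (s ⁻¹' {v}).indicator Z ω * expWeight v (ε ω) := by
  rw [eq_sum_indicator_fiber hs (fun ω => Z ω * expWeight (s ω) (ε ω)) ω]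
  refine Finset.sum_congr rfl fun v _ => ?_
  by_cases h : ω ∈ s ⁻¹' {v}
  · rw [Set.indicator_of_mem h, Set.indicator_of_mem h, show s ω = v from h]
  · rw [Set.indicator_of_notMem h, Set.indicator_of_notMem h, zero_mul]

/-- A conditionally sub-Gaussian vector may be tested against random coefficients that are
measurable with respect to the conditioning σ-algebra. -/
lemma lintegral_mul_expWeight_le (hm : m ≤ mΩ) (hε : ∀ e, Measurable fun ω => ε ω e)
    (hint : ∀ c : κ → ℝ, Integrable (fun ω => Real.exp (∑ e, c e * ε ω e)) μ)
    (hsub : ∀ c : κ → ℝ, μ[fun ω => Real.exp (∑ e, c e * ε ω e) | m]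
      ≤ᵐ[μ] fun _ => Real.exp ((∑ e, c e ^ 2) / 2))
    {c : Ω → κ → ℝ} (hc : ∀ e, Measurable[m] fun ω => c ω e)
    {Z : Ω → ENNReal} (hZ : Measurable[m] Z) :
    ∫⁻ ω, Z ω * expWeight (c ω) (ε ω) ∂μ ≤ ∫⁻ ω, Z ω ∂μ := by
  obtain ⟨s, hfin, hms, hs⟩ := @exists_finite_range_approx _ _ m _ c hc
  have hlim : ∀ ω, Filter.Tendsto (fun n => expWeight (s n ω) (ε ω)) Filter.atTop
      (nhds (expWeight (c ω) (ε ω))) := by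
    intro ω
    have hcont : Continuous fun v : κ → ℝ => expWeight v (ε ω) := by
      unfold expWeight
      refine ENNReal.continuous_ofReal.comp ?_
      fun_prop
    exact (hcont.tendsto _).comp (hs ω)
  have hmsum : ∀ n, Measurable fun ω => Z ω * expWeight (s n ω) (ε ω) := by
    intro n
    simp_rw [mul_expWeight_eq_sum (hfin n)]
    exact Finset.measurable_sum _ fun v _ =>
      ((hZ.indicator (hms n v)).mono hm le_rfl).mul
        (measurable_expWeight hε fun _ => measurable_const)
  calc ∫⁻ ω, Z ω * expWeight (c ω) (ε ω) ∂μ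
      ≤ ∫⁻ ω, Filter.liminf (fun n => Z ω * expWeight (s n ω) (ε ω)) Filter.atTop ∂μ := by
        refine lintegral_mono fun ω => ?_
        -- The limiting weight is nonzero, so multiplication by `Z` respects the limit even where
        -- `Z` is infinite; Fatou's lemma does the rest.
        rw [(ENNReal.Tendsto.const_mul (hlim ω) (Or.inl ?_)).liminf_eq]
        simp [expWeight, Real.exp_pos]
    _ ≤ Filter.liminf (fun n => ∫⁻ ω, Z ω * expWeight (s n ω) (ε ω) ∂μ) Filter.atTop :=
        lintegral_liminf_le hmsum
    _ ≤ ∫⁻ ω, Z ω ∂μ := by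
        refine Filter.liminf_le_of_le (by isBoundedDefault) fun b hb => ?_
        obtain ⟨n, hn⟩ := hb.exists
        refine hn.trans ?_
        simp_rw [mul_expWeight_eq_sum (hfin n)]
        have hmv : ∀ v, Measurable fun ω => (s n ⁻¹' {v}).indicator Z ω * expWeight v (ε ω) :=
          fun v => ((hZ.indicator (hms n v)).mono hm le_rfl).mul
            (measurable_expWeight hε fun _ => measurable_const)
        rw [lintegral_finsetSum _ fun v _ => hmv v]
        refine (Finset.sum_le_sum fun v _ => lintegral_mul_expWeight_const_le hm hε v (hint v)
          (hsub v) (hZ.indicator (hms n v))).trans (le_of_eq ?_)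
        rw [← lintegral_finsetSum _ fun v _ => (hZ.indicator (hms n v)).mono hm le_rfl]
        exact lintegral_congr fun ω => (eq_sum_indicator_fiber (hfin n) Z ω).symm

end SubGaussian

/-! ### Ville's maximal inequality -/

section Ville

variable {Ω : Type*} {mΩ : MeasurableSpace Ω} {μ : Measure Ω}

/-- Ville's maximal inequality for a nonnegative supermartingale. -/
lemma mul_measure_exists_le_lintegral {ℱ : Filtration ℕ mΩ} {Φ : ℕ → Ω → ENNReal} {T : ℕ}
    (hΦ : ∀ t ≤ T, Measurable[ℱ t] (Φ t))
    (hstep : ∀ t < T, ∀ s, MeasurableSet[ℱ t] s →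
      ∫⁻ ω in s, Φ (t + 1) ω ∂μ ≤ ∫⁻ ω in s, Φ t ω ∂μ) (a : ENNReal) :
    a * μ {ω | ∃ t ≤ T, a ≤ Φ t ω} ≤ ∫⁻ ω, Φ 0 ω ∂μ := by
  let bad : ℕ → Set Ω := fun t => {ω | ∃ s ≤ t, a ≤ Φ s ω}
  have hbad : ∀ t ≤ T, MeasurableSet[ℱ t] (bad t) := by
    intro t ht
    have : bad t = ⋃ s ∈ Set.Iic t, {ω | a ≤ Φ s ω} := by ext ω; simp [bad]
    rw [this]
    refine MeasurableSet.biUnion (Set.to_countable _) fun s hs => ?_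
    exact ℱ.mono hs _ (measurableSet_le measurable_const (hΦ s (le_trans hs ht)))
  -- The left side bounds from below the integral of the process stopped when it first reaches `a`:
  -- `a` is credited on the crossed part and the current value elsewhere. The supermartingale step
  -- is used only on the uncrossed set, which belongs to the past.
  have key : ∀ t ≤ T, a * μ (bad t) + ∫⁻ ω in (bad t)ᶜ, Φ t ω ∂μ ≤ ∫⁻ ω, Φ 0 ω ∂μ := by
    intro t
    induction t with
    | zero =>
      intro h0
      have hb := ℱ.le 0 _ (hbad 0 h0)
      rw [← lintegral_add_compl (μ := μ) (Φ 0) hb]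
      have h : a * μ (bad 0) ≤ ∫⁻ ω in bad 0, Φ 0 ω ∂μ := by
        rw [← setLIntegral_const]
        refine setLIntegral_mono' hb ?_
        rintro ω ⟨s, hs, h⟩
        rwa [Nat.le_zero.1 hs] at h
      exact add_le_add h le_rfl
    | succ t ih =>
      intro ht
      have ht' : t ≤ T := by omega
      have hb := ℱ.le _ _ (hbad t ht')
      have hb' := ℱ.le _ _ (hbad (t + 1) ht)
      have hsub : bad t ⊆ bad (t + 1) := fun ω ⟨s, hs, h⟩ => ⟨s, by omega, h⟩
      have h1 := hstep t (by omega) _ (hbad t ht').compl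
      have hunion : (bad t)ᶜ = (bad (t + 1) \ bad t) ∪ (bad (t + 1))ᶜ := by
        ext ω
        have := @hsub ω
        simp only [Set.mem_compl_iff, Set.mem_union, Set.mem_sdiff]
        tauto
      have hdisj : Disjoint (bad (t + 1) \ bad t) (bad (t + 1))ᶜ :=
        Set.disjoint_left.2 fun ω h h' => h' h.1
      have h2 : a * μ (bad (t + 1) \ bad t) ≤ ∫⁻ ω in bad (t + 1) \ bad t, Φ (t + 1) ω ∂μ := by
        rw [← setLIntegral_const]
        refine setLIntegral_mono' (hb'.diff hb) ?_
        rintro ω ⟨⟨s, hs, h⟩, hn⟩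
        rcases Nat.lt_or_ge t s with hts | hts
        · rwa [show s = t + 1 by omega] at h
        · exact absurd ⟨s, hts, h⟩ hn
      calc a * μ (bad (t + 1)) + ∫⁻ ω in (bad (t + 1))ᶜ, Φ (t + 1) ω ∂μ
          = a * μ (bad t) + (a * μ (bad (t + 1) \ bad t)
              + ∫⁻ ω in (bad (t + 1))ᶜ, Φ (t + 1) ω ∂μ) := by
            rw [← add_assoc, ← mul_add, ← measure_union Set.disjoint_sdiff_right (hb'.diff hb),
              Set.union_sdiff_cancel hsub]
        _ ≤ a * μ (bad t) + ∫⁻ ω in (bad t)ᶜ, Φ (t + 1) ω ∂μ := by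
            rw [hunion, lintegral_union hb'.compl hdisj]
            gcongr
        _ ≤ a * μ (bad t) + ∫⁻ ω in (bad t)ᶜ, Φ t ω ∂μ := by gcongr
        _ ≤ _ := ih ht'
  exact le_self_add.trans (key T le_rfl)

end Ville

/-! ### Self-normalized inequality by the method of mixtures -/

section SelfNormalized

variable {Ω : Type*} {ι κ : Type*} [Fintype ι] [Fintype κ]

/-- The noise accumulated along the vectors `X n e`, `1 ≤ n ≤ t`. -/
noncomputable def noiseSum (X : ℕ → κ → ι → ℝ) (ε : ℕ → κ → ℝ) (t : ℕ) : ι → ℝ :=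
  ∑ n ∈ Icc 1 t, ∑ e, ε n e • X n e

lemma dotProduct_noiseSum (X : ℕ → κ → ι → ℝ) (ε : ℕ → κ → ℝ) (t : ℕ) (y : ι → ℝ) :
    y ⬝ᵥ noiseSum X ε t = ∑ n ∈ Icc 1 t, ∑ e, (y ⬝ᵥ X n e) * ε n e := by
  simp only [noiseSum, dotProduct_sum, dotProduct_smul, smul_eq_mul]
  simp only [mul_comm]

variable [DecidableEq ι]

/-- The regularized Gram matrix of the vectors `X n e`, `1 ≤ n ≤ t`. -/
noncomputable def gram (lam : ℝ) (X : ℕ → κ → ι → ℝ) (t : ℕ) : Matrix ι ι ℝ :=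
  lam • (1 : Matrix ι ι ℝ) + ∑ n ∈ Icc 1 t, ∑ e, Matrix.vecMulVec (X n e) (X n e)

lemma quadForm_gram (lam : ℝ) (X : ℕ → κ → ι → ℝ) (t : ℕ) (y : ι → ℝ) :
    y ⬝ᵥ gram lam X t *ᵥ y = lam * (y ⬝ᵥ y) + ∑ n ∈ Icc 1 t, ∑ e, (y ⬝ᵥ X n e) ^ 2 := by
  simp only [gram, Matrix.add_mulVec, dotProduct_add, Matrix.smul_mulVec, Matrix.one_mulVec,
    dotProduct_smul, smul_eq_mul, Matrix.sum_mulVec, dotProduct_sum]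
  congr 1
  refine Finset.sum_congr rfl fun n _ => Finset.sum_congr rfl fun e _ => ?_
  rw [Matrix.vecMulVec_mulVec, op_smul_eq_smul, dotProduct_smul, smul_eq_mul, pow_two,
    dotProduct_comm (X n e) y]

lemma posDef_gram {lam : ℝ} (hlam : 0 < lam) (X : ℕ → κ → ι → ℝ) (t : ℕ) :
    (gram lam X t).PosDef := by
  refine Matrix.PosDef.add_posSemidef (Matrix.PosDef.one.smul hlam) ?_
  refine Matrix.posSemidef_sum _ fun n _ => Matrix.posSemidef_sum _ fun e _ => ?_
  simpa using Matrix.posSemidef_vecMulVec_self_star (X n e)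

variable {mΩ : MeasurableSpace Ω} {μ : Measure Ω} [IsProbabilityMeasure μ] {ℱ : Filtration ℕ mΩ}
  {X : Ω → ℕ → κ → ι → ℝ} {ε : Ω → ℕ → κ → ℝ} {T : ℕ}

/-- The exponential supermartingale in the direction `y`. -/
noncomputable def mixDensity (lam : ℝ) (X : ℕ → κ → ι → ℝ) (ε : ℕ → κ → ℝ) (t : ℕ)
    (y : ι → ℝ) : ENNReal :=
  ENNReal.ofReal (Real.exp (y ⬝ᵥ noiseSum X ε t - (y ⬝ᵥ gram lam X t *ᵥ y) / 2))

lemma measurable_mixDensity {Ω : Type*} [MeasurableSpace Ω] {X : Ω → ℕ → κ → ι → ℝ}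
    {ε : Ω → ℕ → κ → ℝ} {t : ℕ} (lam : ℝ)
    (hX : ∀ n ∈ Icc 1 t, ∀ e i, Measurable fun ω => X ω n e i)
    (hε : ∀ n ∈ Icc 1 t, ∀ e, Measurable fun ω => ε ω n e) :
    Measurable fun p : (ι → ℝ) × Ω => mixDensity lam (X p.2) (ε p.2) t p.1 := by
  have h1 : ∀ n ∈ Icc 1 t, ∀ e, Measurable fun p : (ι → ℝ) × Ω => p.1 ⬝ᵥ X p.2 n e := by
    intro n hn e
    refine Finset.measurable_sum _ fun i _ => ?_
    exact ((measurable_pi_apply i).comp measurable_fst).mul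
      ((hX n hn e i).comp measurable_snd)
  refine ENNReal.measurable_ofReal.comp (Real.measurable_exp.comp (Measurable.sub ?_
    (Measurable.div_const ?_ _)))
  · simp only [dotProduct_noiseSum]
    refine Finset.measurable_sum _ fun n hn => Finset.measurable_sum _ fun e _ => ?_
    exact (h1 n hn e).mul ((hε n hn e).comp measurable_snd)
  · simp only [quadForm_gram]
    refine Measurable.add ?_ ?_
    · unfold dotProduct; fun_prop
    · exact Finset.measurable_sum _ fun n hn => Finset.measurable_sum _ fun e _ =>
        (h1 n hn e).pow_const 2

lemma measurable_mixDensity_right {Ω : Type*} [MeasurableSpace Ω] {X : Ω → ℕ → κ → ι → ℝ}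
    {ε : Ω → ℕ → κ → ℝ} {t : ℕ} (lam : ℝ)
    (hX : ∀ n ∈ Icc 1 t, ∀ e i, Measurable fun ω => X ω n e i)
    (hε : ∀ n ∈ Icc 1 t, ∀ e, Measurable fun ω => ε ω n e) (y : ι → ℝ) :
    Measurable fun ω => mixDensity lam (X ω) (ε ω) t y :=
  Measurable.comp (g := fun p : (ι → ℝ) × Ω => mixDensity lam (X p.2) (ε p.2) t p.1)
    (f := fun ω => (y, ω)) (measurable_mixDensity lam hX hε) measurable_prodMk_left

/-- The mixture of the exponential supermartingales over all directions. -/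
noncomputable def mixture (lam : ℝ) (X : ℕ → κ → ι → ℝ) (ε : ℕ → κ → ℝ) (t : ℕ) : ENNReal :=
  ∫⁻ y, mixDensity lam X ε t y

lemma measurable_mixture {Ω : Type*} [MeasurableSpace Ω] {X : Ω → ℕ → κ → ι → ℝ}
    {ε : Ω → ℕ → κ → ℝ} {t : ℕ} (lam : ℝ)
    (hX : ∀ n ∈ Icc 1 t, ∀ e i, Measurable fun ω => X ω n e i)
    (hε : ∀ n ∈ Icc 1 t, ∀ e, Measurable fun ω => ε ω n e) :
    Measurable fun ω => mixture lam (X ω) (ε ω) t :=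
  (measurable_mixDensity lam hX hε).lintegral_prod_left'

/-- Each round multiplies the density by the exponential weight with coefficients `y ⬝ X (t + 1) e`,
which are known before the noise is drawn. -/
lemma mixDensity_succ (lam : ℝ) (X : ℕ → κ → ι → ℝ) (ε : ℕ → κ → ℝ) (t : ℕ) (y : ι → ℝ) :
    mixDensity lam X ε (t + 1) y
      = mixDensity lam X ε t y * expWeight (fun e => y ⬝ᵥ X (t + 1) e) (ε (t + 1)) := by
  unfold mixDensity expWeight
  rw [← ENNReal.ofReal_mul (Real.exp_pos _).le, ← Real.exp_add]
  simp only [dotProduct_noiseSum, quadForm_gram, Finset.sum_Icc_succ_top (Nat.le_add_left 1 t)]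
  congr 2; ring

/-- The ridge term `lam • 1` inside `gram` acts as an unnormalized Gaussian prior, so integrating
against Lebesgue measure is already the Gaussian mixture. -/
lemma mixture_eq {lam : ℝ} (hlam : 0 < lam) (X : ℕ → κ → ι → ℝ) (ε : ℕ → κ → ℝ)
    (t : ℕ) : mixture lam X ε t = ENNReal.ofReal (Real.exp ((noiseSum X ε t ⬝ᵥ
      (gram lam X t)⁻¹ *ᵥ noiseSum X ε t) / 2) * (√(gram lam X t).det)⁻¹) * gaussianMass ι :=
  lintegral_exp_quadForm (posDef_gram hlam _ _) _

/-- Half the logarithm in the threshold is chosen to cancel `√(det V_t)`: crossing it lifts the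
mixture to `1 / δ` times its initial value. -/
lemma le_mixture {lam δ : ℝ} (hlam : 0 < lam) (hδ : 0 < δ) {X : ℕ → κ → ι → ℝ}
    {ε : ℕ → κ → ℝ} {t : ℕ}
    (h : Real.log ((gram lam X t).det / (lam ^ Fintype.card ι * δ ^ 2))
        ≤ noiseSum X ε t ⬝ᵥ (gram lam X t)⁻¹ *ᵥ noiseSum X ε t) :
    ENNReal.ofReal (δ * √(lam ^ Fintype.card ι))⁻¹ * gaussianMass ι
      ≤ mixture lam X ε t := by
  rw [mixture_eq hlam]
  gcongr
  have hdet := (posDef_gram hlam X t).det_pos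
  have hlamd : 0 < lam ^ Fintype.card ι := by positivity
  rw [Real.log_le_iff_le_exp (by positivity)] at h
  have h2 := Real.sqrt_le_sqrt h
  rw [← Real.exp_half, Real.sqrt_div hdet.le, Real.sqrt_mul hlamd.le, Real.sqrt_sq hδ.le] at h2
  calc (δ * √(lam ^ Fintype.card ι))⁻¹
      = √(gram lam X t).det / (√(lam ^ Fintype.card ι) * δ) * (√(gram lam X t).det)⁻¹ := by
        have := Real.sqrt_pos.2 hdet
        field_simp
    _ ≤ _ := by gcongr

lemma setLIntegral_mixDensity_succ_le {m mΩ : MeasurableSpace Ω} {μ : Measure Ω}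
    [IsProbabilityMeasure μ] {X : Ω → ℕ → κ → ι → ℝ} {ε : Ω → ℕ → κ → ℝ} {t : ℕ} (lam : ℝ)
    (hm : m ≤ mΩ) (hX : ∀ n ∈ Icc 1 (t + 1), ∀ e i, Measurable[m] fun ω => X ω n e i)
    (hε : ∀ n ∈ Icc 1 t, ∀ e, Measurable[m] fun ω => ε ω n e)
    (hε' : ∀ e, Measurable fun ω => ε ω (t + 1) e)
    (hint : ∀ c : κ → ℝ, Integrable (fun ω => Real.exp (∑ e, c e * ε ω (t + 1) e)) μ)
    (hsub : ∀ c : κ → ℝ, μ[fun ω => Real.exp (∑ e, c e * ε ω (t + 1) e) | m]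
      ≤ᵐ[μ] fun _ => Real.exp ((∑ e, c e ^ 2) / 2))
    (y : ι → ℝ) {s : Set Ω} (hs : MeasurableSet[m] s) :
    ∫⁻ ω in s, mixDensity lam (X ω) (ε ω) (t + 1) y ∂μ
      ≤ ∫⁻ ω in s, mixDensity lam (X ω) (ε ω) t y ∂μ := by
  have hc : ∀ e, Measurable[m] fun ω => y ⬝ᵥ X ω (t + 1) e := fun e =>
    Finset.measurable_sum _ fun i _ => (hX _ (by simp) e i).const_mul _
  have hM : Measurable[m] fun ω => mixDensity lam (X ω) (ε ω) t y :=
    @measurable_mixDensity_right _ _ _ _ _ _ m X ε t lam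
      (fun n hn => hX n (Finset.Icc_subset_Icc_right (Nat.le_succ t) hn)) hε y
  rw [← lintegral_indicator (hm _ hs), ← lintegral_indicator (hm _ hs)]
  refine le_trans (le_of_eq (lintegral_congr fun ω => ?_))
    (lintegral_mul_expWeight_le (ε := fun ω => ε ω (t + 1)) hm hε' hint hsub hc
      (hM.indicator hs))
  by_cases h : ω ∈ s
  · simp only [Set.indicator_of_mem h, mixDensity_succ]
  · simp only [Set.indicator_of_notMem h, zero_mul]

variable {mΩ : MeasurableSpace Ω} {μ : Measure Ω} [IsProbabilityMeasure μ] {ℱ : Filtration ℕ mΩ}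
  {X : Ω → ℕ → κ → ι → ℝ} {ε : Ω → ℕ → κ → ℝ} {T : ℕ}

/-- The self-normalized maximal inequality for vector-valued martingales, by the method of
mixtures. -/
lemma measure_exists_log_det_le {lam δ : ℝ} (hlam : 0 < lam) (hδ : 0 < δ)
    (hX : ∀ t < T, ∀ e i, Measurable[ℱ t] fun ω => X ω (t + 1) e i)
    (hε : ∀ t < T, ∀ e, Measurable[ℱ (t + 1)] fun ω => ε ω (t + 1) e)
    (hint : ∀ t < T, ∀ c : κ → ℝ, Integrable (fun ω => Real.exp (∑ e, c e * ε ω (t + 1) e)) μ)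
    (hsub : ∀ t < T, ∀ c : κ → ℝ, μ[fun ω => Real.exp (∑ e, c e * ε ω (t + 1) e) | ℱ t]
      ≤ᵐ[μ] fun _ => Real.exp ((∑ e, c e ^ 2) / 2)) :
    μ {ω | ∃ t ≤ T, Real.log ((gram lam (X ω) t).det / (lam ^ Fintype.card ι * δ ^ 2))
        ≤ noiseSum (X ω) (ε ω) t ⬝ᵥ (gram lam (X ω) t)⁻¹ *ᵥ noiseSum (X ω) (ε ω) t}
      ≤ ENNReal.ofReal δ := by
  have hX1 : ∀ t < T, ∀ n ∈ Icc 1 (t + 1), ∀ e i, Measurable[ℱ t] fun ω => X ω n e i := by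
    intro t ht n hn e i
    rw [Finset.mem_Icc] at hn
    have := hX (n - 1) (by omega) e i
    rw [Nat.sub_add_cancel hn.1] at this
    exact this.mono (ℱ.mono (by omega)) le_rfl
  have hε1 : ∀ t ≤ T, ∀ n ∈ Icc 1 t, ∀ e, Measurable[ℱ t] fun ω => ε ω n e := by
    intro t ht n hn e
    rw [Finset.mem_Icc] at hn
    have := hε (n - 1) (by omega) e
    rw [Nat.sub_add_cancel hn.1] at this
    exact this.mono (ℱ.mono (by omega)) le_rfl
  have hX2 : ∀ t ≤ T, ∀ n ∈ Icc 1 t, ∀ e i, Measurable[ℱ t] fun ω => X ω n e i := by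
    intro t ht n hn e i
    rw [Finset.mem_Icc] at hn
    exact (hX1 (n - 1) (by omega) n (by simp; omega) e i).mono (ℱ.mono (by omega)) le_rfl
  have hΦ : ∀ t ≤ T, Measurable[ℱ t] fun ω => mixture lam (X ω) (ε ω) t :=
    fun t ht => @measurable_mixture _ _ _ _ _ _ (ℱ t) X ε t lam (hX2 t ht) (hε1 t ht)
  have hstep : ∀ t < T, ∀ s, MeasurableSet[ℱ t] s →
      ∫⁻ ω in s, mixture lam (X ω) (ε ω) (t + 1) ∂μ ≤ ∫⁻ ω in s, mixture lam (X ω) (ε ω) t ∂μ := by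
    intro t ht s hs
    -- Tonelli reduces the supermartingale property of the mixture to that of each direction.
    have swap : ∀ r ≤ T, ∫⁻ ω in s, mixture lam (X ω) (ε ω) r ∂μ
        = ∫⁻ y, (∫⁻ ω in s, mixDensity lam (X ω) (ε ω) r y ∂μ) := fun r hr =>
      lintegral_lintegral_swap ((measurable_mixDensity lam
        (fun n hn e i => (hX2 r hr n hn e i).mono (ℱ.le _) le_rfl)
        (fun n hn e => (hε1 r hr n hn e).mono (ℱ.le _) le_rfl)).comp measurable_swap).aemeasurable
    rw [swap _ ht, swap _ ht.le]
    exact lintegral_mono fun y => setLIntegral_mixDensity_succ_le lam (ℱ.le t) (hX1 t ht)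
      (hε1 t ht.le) (fun e => (hε t ht e).mono (ℱ.le _) le_rfl) (hint t ht) (hsub t ht) y hs
  have h0 : ∫⁻ ω, mixture lam (X ω) (ε ω) 0 ∂μ
      = ENNReal.ofReal (√(lam ^ Fintype.card ι))⁻¹ * gaussianMass ι := by
    simp [mixture_eq hlam, gram, noiseSum]
  have hville := mul_measure_exists_le_lintegral hΦ hstep
    (ENNReal.ofReal (δ * √(lam ^ Fintype.card ι))⁻¹ * gaussianMass ι)
  rw [h0] at hville
  refine (measure_mono (t := {ω | ∃ t ≤ T, ENNReal.ofReal (δ * √(lam ^ Fintype.card ι))⁻¹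
    * gaussianMass ι ≤ mixture lam (X ω) (ε ω) t}) ?_).trans ?_
  · rintro ω ⟨t, ht, h⟩
    exact ⟨t, ht, le_mixture hlam hδ h⟩
  have hpos : 0 < √(lam ^ Fintype.card ι) := Real.sqrt_pos.2 (by positivity)
  have hA0 : ENNReal.ofReal (√(lam ^ Fintype.card ι))⁻¹ * gaussianMass ι ≠ 0 :=
    mul_ne_zero (by simpa using hpos) gaussianMass_ne_zero
  have hAt : ENNReal.ofReal (√(lam ^ Fintype.card ι))⁻¹ * gaussianMass ι ≠ ⊤ :=
    ENNReal.mul_ne_top ENNReal.ofReal_ne_top gaussianMass_ne_top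
  generalize μ {ω | ∃ t ≤ T, ENNReal.ofReal (δ * √(lam ^ Fintype.card ι))⁻¹
    * gaussianMass ι ≤ mixture lam (X ω) (ε ω) t} = p at hville ⊢
  -- The initial value of the mixture is a factor of both sides; after its cancellation only `δ`
  -- remains.
  rw [mul_inv, ENNReal.ofReal_mul (by positivity), mul_assoc,
    ENNReal.ofReal_inv_of_pos hδ, mul_assoc, ENNReal.inv_mul_le_iff (by simpa using hδ)
    ENNReal.ofReal_ne_top, mul_comm (ENNReal.ofReal δ), ← mul_assoc] at hville
  exact (ENNReal.mul_le_mul_iff_right hA0 hAt).1 hville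

end SelfNormalized

/-! ### Measurability of matrix operations, finite choices and rewards -/

section Measurability

variable {Ω : Type*} [MeasurableSpace Ω] {ι : Type*} [Fintype ι]

lemma measurable_dotProduct {x y : Ω → ι → ℝ} (hx : ∀ i, Measurable fun ω => x ω i)
    (hy : ∀ i, Measurable fun ω => y ω i) : Measurable fun ω => x ω ⬝ᵥ y ω :=
  Finset.measurable_sum _ fun i _ => (hx i).mul (hy i)

lemma measurable_mulVec_apply {A : Ω → Matrix ι ι ℝ} {x : Ω → ι → ℝ}
    (hA : ∀ i j, Measurable fun ω => A ω i j) (hx : ∀ i, Measurable fun ω => x ω i) (i : ι) :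
    Measurable fun ω => (A ω *ᵥ x ω) i :=
  measurable_dotProduct (hA i) hx

variable [DecidableEq ι]

lemma measurable_det {A : Ω → Matrix ι ι ℝ} (hA : ∀ i j, Measurable fun ω => A ω i j) :
    Measurable fun ω => (A ω).det := by
  simp only [Matrix.det_apply']
  exact Finset.measurable_sum _ fun σ _ =>
    (Finset.measurable_prod _ fun i _ => hA _ _).const_mul _

lemma measurable_inv_apply {A : Ω → Matrix ι ι ℝ} (hA : ∀ i j, Measurable fun ω => A ω i j)
    (i j : ι) : Measurable fun ω => (A ω)⁻¹ i j := by
  simp only [Matrix.inv_def, Matrix.smul_apply, Ring.inverse_eq_inv', smul_eq_mul,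
    Matrix.adjugate_apply]
  refine (measurable_det hA).inv.mul (measurable_det fun k l => ?_)
  by_cases h : k = j
  · simp [Matrix.updateRow_apply, h]
  · simpa [Matrix.updateRow_apply, h] using hA k l

lemma measurable_finite_choice {β γ : Type*} [MeasurableSpace γ] [Finite β]
    {a : Ω → β} (ha : ∀ b, MeasurableSet {ω | a ω = b}) {F : β → Ω → γ}
    (hF : ∀ b, Measurable (F b)) : Measurable fun ω => F (a ω) ω := by
  intro s hs
  have : (fun ω => F (a ω) ω) ⁻¹' s = ⋃ b, {ω | a ω = b} ∩ F b ⁻¹' s := by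
    ext ω; simp
  rw [this]
  exact MeasurableSet.iUnion fun b => (ha b).inter (hF b hs)

end Measurability

lemma measurable_gram_apply {Ω : Type*} [MeasurableSpace Ω] {ι κ : Type*} [DecidableEq ι] [Fintype κ] {X : Ω → ℕ → κ → ι → ℝ} {t : ℕ} (lam : ℝ)
    (hX : ∀ n ∈ Icc 1 t, ∀ e i, Measurable fun ω => X ω n e i) (i j : ι) :
    Measurable fun ω => gram lam (X ω) t i j := by
  simp only [gram, Matrix.add_apply, Matrix.sum_apply, Matrix.vecMulVec_apply]
  exact measurable_const.add (Finset.measurable_sum _ fun n hn =>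
    Finset.measurable_sum _ fun e _ => (hX n hn e i).mul (hX n hn e j))

lemma IsReward.continuous {M m₀ K : ℕ} {P : ℝ} {f : Finset (Arm M m₀) → (Arm M m₀ → ℝ) → ℝ}
    (hf : IsReward K P f) {A : Finset (Arm M m₀)} (hA : A ∈ feasible M m₀ K) :
    Continuous (f A) := by
  rw [continuous_iff_continuousAt]
  intro v
  rw [ContinuousAt, tendsto_iff_norm_sub_tendsto_zero]
  refine squeeze_zero (fun _ => norm_nonneg _) (fun w => hf.lipschitz A hA w v) ?_
  have : Continuous fun w : Arm M m₀ → ℝ => P * √(∑ e ∈ A, (w e - v e) ^ 2) := by fun_prop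
  simpa using this.tendsto v

/-! ### The ridge regression along a trajectory -/

namespace Trajectory

variable {d M m₀ : ℕ}

/-- The feature vectors that enter the regression: those of the arms played in optimistic
rounds. -/
def effX (τ : Trajectory d M m₀) (n : ℕ) (e : Arm M m₀) : Fin d → ℝ :=
  open Classical in if n ∈ τ.N ∧ e ∈ τ.A n then (τ.x n e).ofLp else 0

/-- The noise of the observed weights. -/
noncomputable def noise (τ : Trajectory d M m₀) (θ : EuclideanSpace ℝ (Fin d)) (n : ℕ)
    (e : Arm M m₀) : ℝ :=
  τ.w n e - meanWeight θ (τ.x n) e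

/-- The random index set is replaced by a deterministic interval with an indicator, as induction on
`t` and measurability both require. -/
lemma sum_optRounds {β : Type*} [AddCommMonoid β] {τ : Trajectory d M m₀} {T : ℕ}
    (hN : τ.N ⊆ Icc 1 T) (t : ℕ) (g : ℕ → β) :
    ∑ n ∈ τ.optRounds t, g n = ∑ n ∈ Icc 1 t, if n ∈ τ.N then g n else 0 := by
  rw [← Finset.sum_filter]
  refine Finset.sum_congr ?_ fun _ _ => rfl
  ext n
  simp only [optRounds, Finset.mem_filter, Finset.mem_Icc]
  constructor
  · rintro ⟨h, h'⟩
    exact ⟨⟨(Finset.mem_Icc.1 (hN h)).1, h'⟩, h⟩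
  · rintro ⟨⟨_, h'⟩, h⟩
    exact ⟨h, h'⟩

/-- Unplayed arms and conservative rounds enter as zero vectors, harmless because `g` vanishes
there; this links the algorithm to `gram` and `noiseSum`. -/
lemma sum_optRounds_played {β : Type*} [AddCommMonoid β] {τ : Trajectory d M m₀} {T : ℕ}
    (hN : τ.N ⊆ Icc 1 T) (t : ℕ) (g : ℕ → Arm M m₀ → (Fin d → ℝ) → β) (hg : ∀ n e, g n e 0 = 0) :
    ∑ n ∈ τ.optRounds t, ∑ e ∈ τ.A n, g n e (τ.x n e).ofLp
      = ∑ n ∈ Icc 1 t, ∑ e, g n e (τ.effX n e) := by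
  rw [sum_optRounds hN]
  refine Finset.sum_congr rfl fun n _ => ?_
  by_cases h : n ∈ τ.N
  · rw [if_pos h, ← Finset.sum_filter_add_sum_filter_not univ (· ∈ τ.A n)]
    simp only [Finset.filter_univ_mem]
    rw [Finset.sum_eq_zero (s := univ.filter (· ∉ τ.A n)), add_zero]
    · refine Finset.sum_congr rfl fun e he => ?_
      simp [effX, h, he]
    · intro e he
      simp [effX, (Finset.mem_filter.1 he).2, hg]
  · simp [h, effX, hg]

lemma V_eq_gram {τ : Trajectory d M m₀} {T : ℕ} (hN : τ.N ⊆ Icc 1 T) (lam : ℝ) (t : ℕ) :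
    τ.V lam t = gram lam τ.effX t := by
  rw [V, gram, sum_optRounds_played hN t (fun _ _ x => Matrix.vecMulVec x x) (by simp)]

lemma posDef_V {τ : Trajectory d M m₀} {T : ℕ} (hN : τ.N ⊆ Icc 1 T) {lam : ℝ} (hlam : 0 < lam)
    (t : ℕ) : (τ.V lam t).PosDef := by
  rw [V_eq_gram hN]
  exact posDef_gram hlam _ _

/-- Substituting `w = θᵀ x + noise` leaves the noise sum and `(V - lam) θ`. -/
lemma Y_eq {τ : Trajectory d M m₀} {T : ℕ} (hN : τ.N ⊆ Icc 1 T) (lam : ℝ)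
    (θ : EuclideanSpace ℝ (Fin d)) (t : ℕ) :
    τ.Y t = noiseSum τ.effX (τ.noise θ) t + τ.V lam t *ᵥ θ.ofLp - lam • θ.ofLp := by
  rw [V_eq_gram hN, Y, sum_optRounds_played hN t (fun n e x => τ.w n e • x) (by simp), gram,
    Matrix.add_mulVec, Matrix.smul_mulVec, Matrix.one_mulVec, noiseSum, Matrix.sum_mulVec]
  have h : ∀ n e, τ.w n e • τ.effX n e = τ.noise θ n e • τ.effX n e
      + Matrix.vecMulVec (τ.effX n e) (τ.effX n e) *ᵥ θ.ofLp := by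
    intro n e
    rw [Matrix.vecMulVec_mulVec, op_smul_eq_smul, ← add_smul]
    by_cases hne : n ∈ τ.N ∧ e ∈ τ.A n
    · have : τ.effX n e = (τ.x n e).ofLp := by simp [effX, hne]
      rw [this, noise, meanWeight, EuclideanSpace.inner_eq_star_dotProduct]
      simp
    · simp [effX, hne]
  simp only [Matrix.sum_mulVec, h, Finset.sum_add_distrib]
  abel

/-- The ridge estimate stays in the confidence ellipsoid as long as the self-normalized noise is
small. -/
lemma abs_thetaHat_sub_le {τ : Trajectory d M m₀} {T : ℕ} (hN : τ.N ⊆ Icc 1 T) {lam S δ : ℝ}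
    (hlam : 0 < lam) {θ : EuclideanSpace ℝ (Fin d)} (hθ : ‖θ‖ ≤ S) {t : ℕ}
    (h : noiseSum τ.effX (τ.noise θ) t ⬝ᵥ (gram lam τ.effX t)⁻¹ *ᵥ noiseSum τ.effX (τ.noise θ) t
      < Real.log ((gram lam τ.effX t).det / (lam ^ d * δ ^ 2))) (y : Fin d → ℝ) :
    |τ.thetaHat lam t ⬝ᵥ y - θ.ofLp ⬝ᵥ y|
      ≤ τ.H lam S δ t * √(y ⬝ᵥ (τ.V lam t)⁻¹ *ᵥ y) := by
  rw [← V_eq_gram hN] at h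
  have hV := posDef_V hN hlam t
  set W := (τ.V lam t)⁻¹ with hW
  set s := noiseSum τ.effX (τ.noise θ) t
  have hWs : W.PosSemidef := hV.inv.posSemidef
  -- The estimation error is `V⁻¹ (s - lam θ)`: a noise part, controlled by the event, and a
  -- regularization bias of size `√lam S`.
  have e : τ.thetaHat lam t ⬝ᵥ y - θ.ofLp ⬝ᵥ y = y ⬝ᵥ W *ᵥ (s - lam • θ.ofLp) := by
    rw [thetaHat, Y_eq hN lam θ, add_sub_right_comm, Matrix.mulVec_add, inv_mulVec_mulVec hV,
      add_dotProduct, add_sub_cancel_right, dotProduct_comm]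
  rw [e]
  refine (abs_dotProduct_mulVec_le hWs _ _).trans ?_
  rw [mul_comm]
  refine mul_le_mul_of_nonneg_right ?_ (Real.sqrt_nonneg _)
  refine (sqrt_quadForm_sub_le hWs _ _).trans ?_
  rw [H, add_comm]
  refine add_le_add ?_ (Real.sqrt_le_sqrt h.le)
  have hθ0 : 0 ≤ S := (norm_nonneg _).trans hθ
  have hbound : (lam • θ.ofLp) ⬝ᵥ W *ᵥ (lam • θ.ofLp) ≤ lam * S ^ 2 := by
    -- The comparison matrix is `lam I`, written as a Gram matrix over an empty set of arms; `V`
    -- dominates it.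
    have h1 := quadForm_inv_antitone (V := gram lam (fun _ (_ : Fin 0) => (0 : Fin d → ℝ)) 0)
      (posDef_gram hlam _ _) hV (fun z => by
        rw [V_eq_gram hN, quadForm_gram, quadForm_gram]
        simp only [Finset.univ_eq_empty, Finset.sum_empty, Finset.sum_const_zero, add_zero]
        have : 0 ≤ ∑ n ∈ Icc 1 t, ∑ e, (z ⬝ᵥ τ.effX n e) ^ 2 :=
          Finset.sum_nonneg fun n _ => Finset.sum_nonneg fun e _ => sq_nonneg _
        linarith) (lam • θ.ofLp)
    refine h1.trans ?_
    have hinv : (lam • (1 : Matrix (Fin d) (Fin d) ℝ))⁻¹ = lam⁻¹ • 1 := by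
      apply Matrix.inv_eq_right_inv
      simp [hlam.ne']
    simp only [gram, Finset.univ_eq_empty, Finset.sum_empty, Finset.sum_const_zero, add_zero, hinv,
      Matrix.smul_mulVec, Matrix.one_mulVec, smul_dotProduct, dotProduct_smul, smul_eq_mul]
    have hn : θ.ofLp ⬝ᵥ θ.ofLp = ‖θ‖ ^ 2 := by
      rw [EuclideanSpace.norm_sq_eq]
      simp [dotProduct, pow_two]
    rw [hn]
    calc lam⁻¹ * (lam * (lam * ‖θ‖ ^ 2)) = lam * ‖θ‖ ^ 2 := by field_simp
      _ ≤ lam * S ^ 2 := by gcongr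
  calc _ ≤ √(lam * S ^ 2) := Real.sqrt_le_sqrt hbound
    _ = √lam * S := by rw [Real.sqrt_mul hlam.le, Real.sqrt_sq hθ0]

/-! ### Predictability of the algorithm's choices and the confidence event -/

section Run

variable {K T : ℕ} {f : Finset (Arm M m₀) → (Arm M m₀ → ℝ) → ℝ} {α μ₀ lam S δ P : ℝ}

lemma IsRun.candidate_mem {τ : Trajectory d M m₀} (h : τ.IsRun K T f α μ₀ lam S δ) {t : ℕ}
    (ht : t ∈ Icc 1 T) : τ.B t ∈ feasible M m₀ K := by
  by_cases hc : ∀ A ∈ alternatives M m₀ K, f A (τ.U lam S δ t t) < μ₀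
  · rw [h.candidate_conservative t ht hc]
    exact Finset.mem_insert_self _ _
  · exact Finset.mem_insert_of_mem (h.candidate_alternative t ht hc).1

lemma IsRun.played_mem {τ : Trajectory d M m₀} (h : τ.IsRun K T f α μ₀ lam S δ) {t : ℕ}
    (ht : t ∈ Icc 1 T) : τ.A t ∈ feasible M m₀ K := by
  by_cases hN : t ∈ τ.N
  · rw [h.play_opt t ht hN]
    exact h.candidate_mem ht
  · rw [h.play_cons t ht hN]
    exact Finset.mem_insert_self _ _

lemma card_consRounds (τ : Trajectory d M m₀) (t : ℕ) :
    ((τ.consRounds t).card : ℝ) = ∑ n ∈ Icc 1 t, if n ∈ τ.N then (0 : ℝ) else 1 := by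
  rw [consRounds, ← Finset.filter_notMem_eq_sdiff, Finset.card_filter]
  push_cast
  exact Finset.sum_congr rfl fun n _ => by split_ifs <;> simp_all

section

variable {Ω : Type*} [MeasurableSpace Ω] {τ : Ω → Trajectory d M m₀}

lemma measurable_effX {n : ℕ} (hx : ∀ e, Measurable fun ω => (τ ω).x n e)
    (hA : ∀ a, MeasurableSet {ω | (τ ω).A n = a}) (hN : MeasurableSet {ω | n ∈ (τ ω).N})
    (e : Arm M m₀) (i : Fin d) : Measurable fun ω => (τ ω).effX n e i := by
  have hmem : MeasurableSet {ω | e ∈ (τ ω).A n} := by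
    have : {ω | e ∈ (τ ω).A n} = ⋃ a ∈ {a : Finset (Arm M m₀) | e ∈ a}, {ω | (τ ω).A n = a} := by
      ext ω; simp
    rw [this]
    exact MeasurableSet.biUnion (Set.to_countable _) fun a _ => hA a
  have h : MeasurableSet {ω | n ∈ (τ ω).N ∧ e ∈ (τ ω).A n} := hN.inter hmem
  have hi : Measurable fun ω => ((τ ω).x n e).ofLp i := by
    have := hx e
    fun_prop
  classical
  have : (fun ω => (τ ω).effX n e i)
      = fun ω => if n ∈ (τ ω).N ∧ e ∈ (τ ω).A n then ((τ ω).x n e).ofLp i else 0 := by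
    funext ω
    by_cases hne : n ∈ (τ ω).N ∧ e ∈ (τ ω).A n <;> simp [effX, hne]
  rw [this]
  exact Measurable.ite h hi measurable_const

lemma measurable_psi {t : ℕ} (hf : IsReward K P f)
    (hx : ∀ n ∈ Icc 1 t, ∀ e, Measurable fun ω => (τ ω).x n e)
    (hw : ∀ n ∈ Icc 1 (t - 1), ∀ e, Measurable fun ω => (τ ω).w n e)
    (hB : ∀ a, MeasurableSet {ω | (τ ω).B t = a})
    (hA : ∀ n ∈ Icc 1 (t - 1), ∀ a, MeasurableSet {ω | (τ ω).A n = a})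
    (hN : ∀ n ∈ Icc 1 (t - 1), MeasurableSet {ω | n ∈ (τ ω).N})
    (hrun : ∀ ω, (τ ω).IsRun K T f α μ₀ lam S δ) (ht : t ∈ Icc 1 T) :
    Measurable fun ω => (τ ω).psi f μ₀ lam S δ t := by
  have ht' := Finset.mem_Icc.1 ht
  have hX : ∀ n ∈ Icc 1 (t - 1), ∀ e i, Measurable fun ω => (τ ω).effX n e i := fun n hn =>
    measurable_effX (hx n (Finset.Icc_subset_Icc_right (Nat.sub_le _ _) hn)) (hA n hn) (hN n hn)
  have hV : ∀ i j, Measurable fun ω => (τ ω).V lam (t - 1) i j := by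
    intro i j
    simp_rw [fun ω => V_eq_gram (hrun ω).opt_subset lam (t - 1)]
    exact measurable_gram_apply lam hX i j
  have hY : ∀ i, Measurable fun ω => (τ ω).Y (t - 1) i := by
    intro i
    have : ∀ ω, (τ ω).Y (t - 1) i
        = ∑ n ∈ Icc 1 (t - 1), ∑ e, (τ ω).w n e * (τ ω).effX n e i := by
      intro ω
      rw [Y, sum_optRounds_played (hrun ω).opt_subset (t - 1) (fun n e x => (τ ω).w n e • x)
        (by simp)]
      simp
    simp_rw [this]
    exact Finset.measurable_sum _ fun n hn => Finset.measurable_sum _ fun e _ =>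
      (hw n hn e).mul (hX n hn e i)
  have hx' : ∀ n ∈ Icc 1 t, ∀ e i, Measurable fun ω => ((τ ω).x n e).ofLp i := by
    intro n hn e i
    have := hx n hn e
    fun_prop
  have hLo : ∀ n ∈ Icc 1 t, Measurable fun ω => (τ ω).Lo lam S δ t n := by
    intro n hn
    refine measurable_pi_lambda _ fun e => ?_
    refine measurable_const.max (Measurable.sub ?_ (Measurable.mul ?_ ?_))
    · exact measurable_dotProduct
        (measurable_mulVec_apply (measurable_inv_apply hV) hY) (hx' n hn e)
    · exact measurable_const.add (((measurable_det hV).div_const _).log.sqrt)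
    · exact (measurable_dotProduct (hx' n hn e)
        (measurable_mulVec_apply (measurable_inv_apply hV) (hx' n hn e))).sqrt
  have hfA : ∀ (a : Ω → Finset (Arm M m₀)), (∀ b, MeasurableSet {ω | a ω = b}) →
      (∀ ω, a ω ∈ feasible M m₀ K) → ∀ n ∈ Icc 1 t,
      Measurable fun ω => f (a ω) ((τ ω).Lo lam S δ t n) := by
    intro a ha hmem n hn
    classical
    have h := measurable_finite_choice ha
      -- Regularity of `f` is known for feasible actions only, hence the default value `0`, which is
      -- never attained by this route.
      (F := fun b ω => if b ∈ feasible M m₀ K then f b ((τ ω).Lo lam S δ t n) else 0) (by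
        intro b
        by_cases hb : b ∈ feasible M m₀ K
        · simp only [hb, if_true]
          exact (hf.continuous hb).measurable.comp (hLo n hn)
        · simp only [hb, if_false]
          exact measurable_const)
    simpa only [hmem, if_true] using h
  unfold psi
  simp_rw [card_consRounds, fun ω => sum_optRounds (hrun ω).opt_subset (t - 1)
    (fun n => f ((τ ω).A n) ((τ ω).Lo lam S δ t n))]
  refine Measurable.add (Measurable.add ?_ ?_) (Measurable.mul_const ?_ _)
  · refine Finset.measurable_sum _ fun n hn => Measurable.ite (hN n hn) ?_ measurable_const
    have hn' := Finset.Icc_subset_Icc_right (Nat.sub_le t 1) hn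
    exact hfA _ (hA n hn) (fun ω => (hrun ω).played_mem
      (Finset.Icc_subset_Icc_right ht'.2 hn')) n hn'
  · exact Measurable.ite (hB _) measurable_const
      (hfA _ hB (fun ω => (hrun ω).candidate_mem ht) t (Finset.mem_Icc.2 ⟨ht'.1, le_rfl⟩))
  · exact Finset.measurable_sum _ fun n hn =>
      Measurable.ite (hN n hn) measurable_const measurable_const

lemma measurableSet_played {n : ℕ} (hB : ∀ a, MeasurableSet {ω | (τ ω).B n = a})
    (hN : MeasurableSet {ω | n ∈ (τ ω).N}) (hrun : ∀ ω, (τ ω).IsRun K T f α μ₀ lam S δ)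
    (hn : n ∈ Icc 1 T) (a : Finset (Arm M m₀)) : MeasurableSet {ω | (τ ω).A n = a} := by
  have : {ω | (τ ω).A n = a} = ({ω | n ∈ (τ ω).N} ∩ {ω | (τ ω).B n = a})
      ∪ ({ω | n ∈ (τ ω).N}ᶜ ∩ {_ω | conservative M m₀ = a}) := by
    ext ω
    by_cases h : n ∈ (τ ω).N
    · simp [h, (hrun ω).play_opt n hn h]
    · simp [h, (hrun ω).play_cons n hn h]
  rw [this]
  exact (hN.inter (hB a)).union (hN.compl.inter (MeasurableSet.const _))

end

variable {Ω : Type u} [mΩ : MeasurableSpace Ω] {ℙ : Measure Ω} {ℱ : Filtration ℕ mΩ}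
  {τ : Ω → Trajectory d M m₀} {θ : EuclideanSpace ℝ (Fin d)}

/-- Strong induction: the branch of round `t` is decided by `psi`, which depends on the earlier
branches, the earlier weights, the features up to `t` and the candidates up to `t`. -/
lemma measurableSet_mem_opt (hf : IsReward K P f) (hmod : IsStochasticModel ℙ ℱ T θ τ)
    (hrun : ∀ ω, (τ ω).IsRun K T f α μ₀ lam S δ) (t : ℕ) (ht : t ∈ Icc 1 T) :
    MeasurableSet[ℱ (t - 1)] {ω | t ∈ (τ ω).N} := by
  induction t using Nat.strong_induction_on with
  | _ t ih =>
    have ht' := Finset.mem_Icc.1 ht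
    have hmem : ∀ n ∈ Icc 1 (t - 1), n ∈ Icc 1 T ∧ n < t := by
      intro n hn
      rw [Finset.mem_Icc] at *
      omega
    have hN : ∀ n ∈ Icc 1 (t - 1), MeasurableSet[ℱ (t - 1)] {ω | n ∈ (τ ω).N} := fun n hn =>
      ℱ.mono (by have := hmem n hn; omega) _ (ih n (hmem n hn).2 (hmem n hn).1)
    have hB : ∀ n ∈ Icc 1 t, ∀ a, MeasurableSet[ℱ (t - 1)] {ω | (τ ω).B n = a} := fun n hn a =>
      ℱ.mono (by rw [Finset.mem_Icc] at hn; omega) _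
        (hmod.candidate_predictable n (Finset.Icc_subset_Icc_right ht'.2 hn) a)
    have hpsi := @measurable_psi d M m₀ K T f α μ₀ lam S δ P Ω (ℱ (t - 1)) τ t hf
      (fun n hn e => (hmod.features_predictable n (Finset.Icc_subset_Icc_right ht'.2 hn) e).mono
        (ℱ.mono (by rw [Finset.mem_Icc] at hn; omega)) le_rfl)
      (fun n hn e => (hmod.weights_adapted n (hmem n hn).1 e).mono
        (ℱ.mono (by rw [Finset.mem_Icc] at hn; omega)) le_rfl)
      (hB t (Finset.mem_Icc.2 ⟨ht'.1, le_rfl⟩))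
      (fun n hn => @measurableSet_played d M m₀ K T f α μ₀ lam S δ Ω (ℱ (t - 1)) τ n
        (hB n (Finset.Icc_subset_Icc_right (Nat.sub_le _ _) hn)) (hN n hn) hrun (hmem n hn).1)
      hN hrun ht
    have : {ω | t ∈ (τ ω).N}
        = {ω | (1 - α) * t * μ₀ ≤ (τ ω).psi f μ₀ lam S δ t} := by
      ext ω
      exact (hrun ω).opt_iff t ht
    rw [this]
    exact @measurableSet_le _ _ _ _ _ (ℱ (t - 1)) _ _ _ _ _ measurable_const hpsi

/-- With probability at least `1 - δ` the true parameter lies in all the confidence ellipsoids. -/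
lemma le_measure_confidence [IsProbabilityMeasure ℙ] (hf : IsReward K P f)
    (hmod : IsStochasticModel ℙ ℱ T θ τ) (hrun : ∀ ω, (τ ω).IsRun K T f α μ₀ lam S δ)
    (hlam : 0 < lam) (hδ : 0 < δ) (hθ : ‖θ‖ ≤ S) :
    ENNReal.ofReal (1 - δ) ≤ ℙ {ω | ∀ t ≤ T, ∀ y : Fin d → ℝ,
      |(τ ω).thetaHat lam t ⬝ᵥ y - θ.ofLp ⬝ᵥ y|
        ≤ (τ ω).H lam S δ t * √(y ⬝ᵥ ((τ ω).V lam t)⁻¹ *ᵥ y)} := by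
  have hIcc : ∀ t < T, t + 1 ∈ Icc 1 T := fun t ht => Finset.mem_Icc.2 (by omega)
  have hN : ∀ t < T, MeasurableSet[ℱ t] {ω | t + 1 ∈ (τ ω).N} := fun t ht =>
    measurableSet_mem_opt hf hmod hrun (t + 1) (hIcc t ht)
  have hx : ∀ t < T, ∀ e, Measurable[ℱ t] fun ω => (τ ω).x (t + 1) e := fun t ht =>
    hmod.features_predictable (t + 1) (hIcc t ht)
  have hbad := measure_exists_log_det_le (μ := ℙ) (ℱ := ℱ) (T := T) (X := fun ω => (τ ω).effX)
    (ε := fun ω => (τ ω).noise θ) hlam hδ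
    (fun t ht => @measurable_effX d M m₀ Ω (ℱ t) τ (t + 1) (hx t ht)
      (@measurableSet_played d M m₀ K T f α μ₀ lam S δ Ω (ℱ t) τ (t + 1)
        (hmod.candidate_predictable (t + 1) (hIcc t ht)) (hN t ht) hrun (hIcc t ht)) (hN t ht))
    (fun t ht e => by
      refine (hmod.weights_adapted (t + 1) (hIcc t ht) e).sub ?_
      have h1 := (hx t ht e).mono (ℱ.mono (Nat.le_succ t)) le_rfl
      exact ((innerSL ℝ θ).continuous.measurable).comp h1)
    (fun t ht c => hmod.noise_integrable (t + 1) (hIcc t ht) c)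
    (fun t ht c => hmod.noise_subGaussian (t + 1) (hIcc t ht) c)
  rw [Fintype.card_fin] at hbad
  set bad := {ω | ∃ t ≤ T, Real.log ((gram lam (τ ω).effX t).det / (lam ^ d * δ ^ 2))
    ≤ noiseSum (τ ω).effX ((τ ω).noise θ) t ⬝ᵥ
      (gram lam (τ ω).effX t)⁻¹ *ᵥ noiseSum (τ ω).effX ((τ ω).noise θ) t}
  set good := {ω | ∀ t ≤ T, ∀ y : Fin d → ℝ,
      |(τ ω).thetaHat lam t ⬝ᵥ y - θ.ofLp ⬝ᵥ y|
        ≤ (τ ω).H lam S δ t * √(y ⬝ᵥ ((τ ω).V lam t)⁻¹ *ᵥ y)}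
  -- A covering together with subadditivity avoids having to show that the good event is measurable.
  have hcover : (Set.univ : Set Ω) ⊆ good ∪ bad := by
    intro ω _
    by_cases h : ω ∈ bad
    · exact Or.inr h
    · refine Or.inl fun t ht y => ?_
      refine abs_thetaHat_sub_le (hrun ω).opt_subset hlam hθ ?_ y
      by_contra hc
      exact h ⟨t, ht, not_lt.1 hc⟩
  have h1 : 1 ≤ ℙ good + ENNReal.ofReal δ := by
    calc 1 = ℙ Set.univ := measure_univ.symm
      _ ≤ ℙ good + ℙ bad := (measure_mono hcover).trans (measure_union_le _ _)
      _ ≤ _ := by gcongr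
  rw [ENNReal.ofReal_sub _ hδ.le, ENNReal.ofReal_one]
  exact tsub_le_iff_right.2 h1

end Run

end Trajectory

/-! ### Widths, elliptical potential and the confidence radius -/

lemma card_le_of_mem_feasible {M m₀ K : ℕ} (hm₀ : m₀ ≤ K) {A : Finset (Arm M m₀)}
    (hA : A ∈ feasible M m₀ K) : A.card ≤ K := by
  rcases Finset.mem_insert.1 hA with rfl | hA
  · refine le_trans (le_of_eq ?_) hm₀
    have : conservative M m₀ = univ.map Function.Embedding.inr := by
      ext e
      rcases e with e | e <;> simp [conservative]
    rw [this]
    simp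
  · exact (Finset.mem_filter.1 (Finset.mem_of_mem_erase hA)).2

/-- Monotonicity moves to the shifted weights, then the Lipschitz bound pays for the shift. `|P|`
appears since no sign of `P` is assumed. -/
lemma IsReward.le_add {M m₀ K : ℕ} {P : ℝ} {f : Finset (Arm M m₀) → (Arm M m₀ → ℝ) → ℝ}
    (hf : IsReward K P f) {A : Finset (Arm M m₀)} (hA : A ∈ feasible M m₀ K)
    {w v a : Arm M m₀ → ℝ} {b : ℝ} (hb : 0 ≤ b) (h : ∀ e ∈ A, w e ≤ v e + b * a e) :
    f A w ≤ f A v + |P| * b * √(∑ e ∈ A, a e ^ 2) := by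
  have h1 := hf.mono A hA w (fun e => v e + b * a e) h
  have h2 := (le_abs_self _).trans (hf.lipschitz A hA (fun e => v e + b * a e) v)
  have h3 : √(∑ e ∈ A, (v e + b * a e - v e) ^ 2) = b * √(∑ e ∈ A, a e ^ 2) := by
    simp only [add_sub_cancel_left, mul_pow, ← Finset.mul_sum]
    rw [Real.sqrt_mul (sq_nonneg b), Real.sqrt_sq hb]
  rw [h3] at h2
  have h4 : P * (b * √(∑ e ∈ A, a e ^ 2)) ≤ |P| * (b * √(∑ e ∈ A, a e ^ 2)) :=
    mul_le_mul_of_nonneg_right (le_abs_self P) (by positivity)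
  linarith

/-- With `u = min 1 g`, `log (1 + u) ≥ u / (1 + u) ≥ u / 2`. -/
lemma min_one_div_two_le_log {g : ℝ} (hg : 0 ≤ g) : min 1 g / 2 ≤ Real.log (1 + g) := by
  have hu : 0 ≤ min 1 g := le_min zero_le_one hg
  have h1 : Real.log (1 + min 1 g) ≤ Real.log (1 + g) :=
    Real.log_le_log (by linarith) (by linarith [min_le_right 1 g])
  refine le_trans ?_ h1
  refine le_trans ?_ (Real.one_sub_inv_le_log_of_pos (by linarith))
  have : 1 - (1 + min 1 g)⁻¹ = min 1 g / (1 + min 1 g) := by field_simp; ring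
  rw [this]
  gcongr
  linarith [min_le_left 1 g]

namespace Trajectory

variable {d M m₀ : ℕ}

/-- The squared total width of the action played in round `n`, in the norm of `V_{n-1}⁻¹`. -/
noncomputable def energy (τ : Trajectory d M m₀) (lam : ℝ) (n : ℕ) : ℝ :=
  ∑ e ∈ τ.A n, τ.width lam (n - 1) n e ^ 2

lemma energy_nonneg (τ : Trajectory d M m₀) (lam : ℝ) (n : ℕ) : 0 ≤ τ.energy lam n :=
  Finset.sum_nonneg fun _ _ => sq_nonneg _

variable {τ : Trajectory d M m₀} {K T : ℕ} {lam : ℝ}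

lemma width_sq (hN : τ.N ⊆ Icc 1 T) (hlam : 0 < lam) (t s : ℕ) (e : Arm M m₀) :
    τ.width lam t s e ^ 2 = (τ.x s e).ofLp ⬝ᵥ ((τ.V lam t)⁻¹ *ᵥ (τ.x s e).ofLp) :=
  Real.sq_sqrt (quadForm_nonneg (posDef_V hN hlam t).inv.posSemidef _)

lemma width_antitone (hN : τ.N ⊆ Icc 1 T) (hlam : 0 < lam) {t t' : ℕ} (h : t ≤ t') (s : ℕ)
    (e : Arm M m₀) : τ.width lam t' s e ≤ τ.width lam t s e := by
  refine Real.sqrt_le_sqrt (quadForm_inv_antitone (posDef_V hN hlam t) (posDef_V hN hlam t')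
    (fun y => ?_) _)
  rw [V_eq_gram hN, V_eq_gram hN, quadForm_gram, quadForm_gram]
  have := Finset.sum_le_sum_of_subset_of_nonneg (Finset.Icc_subset_Icc_right (a := 1) h)
    (f := fun n => ∑ e, (y ⬝ᵥ τ.effX n e) ^ 2)
    (fun _ _ _ => Finset.sum_nonneg fun _ _ => sq_nonneg _)
  linarith

lemma V_succ (hN : τ.N ⊆ Icc 1 T) (lam : ℝ) (t : ℕ) :
    τ.V lam (t + 1) = τ.V lam t + if t + 1 ∈ τ.N then
      ∑ e ∈ τ.A (t + 1), Matrix.vecMulVec (τ.x (t + 1) e).ofLp (τ.x (t + 1) e).ofLp else 0 := by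
  rw [V, V, sum_optRounds hN, sum_optRounds hN, Finset.sum_Icc_succ_top (Nat.le_add_left 1 t),
    add_assoc]

/-- The elliptical potential lemma for batches of feature vectors. -/
lemma sum_min_energy_le (hN : τ.N ⊆ Icc 1 T) (hlam : 0 < lam) (t : ℕ) :
    ∑ n ∈ τ.optRounds t, min 1 (τ.energy lam n)
      ≤ 2 * Real.log ((τ.V lam t).det / lam ^ d) := by
  rw [sum_optRounds hN]
  induction t with
  | zero =>
    have : τ.V lam 0 = lam • 1 := by rw [V_eq_gram hN]; simp [gram]
    rw [this]
    simp [hlam.ne']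
  | succ t ih =>
    rw [Finset.sum_Icc_succ_top (Nat.le_add_left 1 t)]
    have hpos := (posDef_V hN hlam t).det_pos
    have hpos' := (posDef_V hN hlam (t + 1)).det_pos
    have hlamd : 0 < lam ^ d := by positivity
    rw [Real.log_div hpos.ne' hlamd.ne'] at ih
    rw [Real.log_div hpos'.ne' hlamd.ne']
    by_cases h : t + 1 ∈ τ.N
    · have h1 := det_mul_one_add_sum_le _ (posDef_V hN hlam t) (fun e => (τ.x (t + 1) e).ofLp)
        (τ.A (t + 1))
      have h2 : τ.energy lam (t + 1) = ∑ e ∈ τ.A (t + 1),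
          (τ.x (t + 1) e).ofLp ⬝ᵥ ((τ.V lam t)⁻¹ *ᵥ (τ.x (t + 1) e).ofLp) :=
        Finset.sum_congr rfl fun e _ => width_sq hN hlam _ _ _
      rw [← h2] at h1
      have h3 := V_succ hN lam t
      rw [if_pos h] at h3
      rw [← h3] at h1
      have h4 : 0 < 1 + τ.energy lam (t + 1) := by linarith [τ.energy_nonneg lam (t + 1)]
      have h5 := Real.log_le_log (by positivity) h1
      rw [Real.log_mul hpos.ne' h4.ne'] at h5
      have h6 := min_one_div_two_le_log (τ.energy_nonneg lam (t + 1))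
      rw [if_pos h]
      linarith
    · have h3 := V_succ hN lam t
      rw [if_neg h, add_zero] at h3
      rw [if_neg h, h3]
      linarith

/-- Each of at most `T K` features adds at most `lam` to the trace `lam d`; the determinant is then
bounded through the trace. -/
lemma log_det_le (hN : τ.N ⊆ Icc 1 T) (hlam : 0 < lam) (hd : 1 ≤ d)
    (hx : ∀ t ∈ Icc 1 T, ∀ e, ‖τ.x t e‖ ^ 2 ≤ lam) (hA : ∀ t ∈ Icc 1 T, (τ.A t).card ≤ K)
    (t : ℕ) :
    Real.log ((τ.V lam t).det / lam ^ d) ≤ d * Real.log (1 + (T : ℝ) * K / d) := by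
  have hd0 : (0 : ℝ) < d := by exact_mod_cast hd
  have hdet := (posDef_V hN hlam t).det_pos
  have hlamd : 0 < lam ^ d := by positivity
  have : Nonempty (Fin d) := ⟨⟨0, hd⟩⟩
  have htr : (τ.V lam t).trace ≤ lam * d + T * K * lam := by
    have h1 : (τ.V lam t).trace = lam * d + ∑ n ∈ τ.optRounds t, ∑ e ∈ τ.A n, ‖τ.x n e‖ ^ 2 := by
      simp only [V, Matrix.trace_add, Matrix.trace_smul, Matrix.trace_one, Matrix.trace_sum,
        Matrix.trace_vecMulVec, EuclideanSpace.norm_sq_eq, Fintype.card_fin, smul_eq_mul]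
      simp [dotProduct, pow_two]
    have hsub : τ.optRounds t ⊆ Icc 1 T := (Finset.filter_subset _ _).trans hN
    have h2 : ∑ n ∈ τ.optRounds t, ∑ e ∈ τ.A n, ‖τ.x n e‖ ^ 2 ≤ ∑ n ∈ Icc 1 T, (K : ℝ) * lam := by
      refine (Finset.sum_le_sum_of_subset_of_nonneg hsub fun _ _ _ =>
        Finset.sum_nonneg fun _ _ => sq_nonneg _).trans (Finset.sum_le_sum fun n hn => ?_)
      refine (Finset.sum_le_card_nsmul _ _ lam fun e _ => hx n hn e).trans ?_
      rw [nsmul_eq_mul]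
      gcongr
      exact_mod_cast hA n hn
    simp only [Finset.sum_const, Nat.card_Icc, nsmul_eq_mul, Nat.add_sub_cancel] at h2
    linarith
  have h1 : (τ.V lam t).det ≤ (lam * (1 + T * K / d)) ^ d := by
    have h := det_le_trace_div_card_pow (posDef_V hN hlam t).posSemidef
    rw [Fintype.card_fin] at h
    refine h.trans (pow_le_pow_left₀ (div_nonneg
      (posDef_V hN hlam t).posSemidef.trace_nonneg hd0.le) ?_ _)
    rw [div_le_iff₀ hd0]
    refine htr.trans (le_of_eq ?_)
    field_simp
  rw [← Real.log_pow]
  refine Real.log_le_log (by positivity) ?_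
  rw [div_le_iff₀ hlamd, mul_comm, ← mul_pow]
  exact h1

/-- Cauchy–Schwarz over at most `T` optimistic rounds; squaring `min 1 √g` gives `min 1 g`, to which
the potential lemma applies. -/
lemma sum_min_sqrt_energy_le (hN : τ.N ⊆ Icc 1 T) (hlam : 0 < lam) (hd : 1 ≤ d)
    (hx : ∀ t ∈ Icc 1 T, ∀ e, ‖τ.x t e‖ ^ 2 ≤ lam) (hA : ∀ t ∈ Icc 1 T, (τ.A t).card ≤ K) :
    ∑ n ∈ τ.N, min 1 √(τ.energy lam n) ≤ √(T * (2 * (d * Real.log (1 + (T : ℝ) * K / d)))) := by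
  refine Real.le_sqrt_of_sq_le ?_
  have hopt : τ.optRounds T = τ.N :=
    Finset.filter_true_of_mem fun n hn => (Finset.mem_Icc.1 (hN hn)).2
  have h1 := sum_min_energy_le hN hlam T
  rw [hopt] at h1
  have h2 := log_det_le hN hlam hd hx hA T
  have h3 : ∑ n ∈ τ.N, (min 1 √(τ.energy lam n)) ^ 2 = ∑ n ∈ τ.N, min 1 (τ.energy lam n) := by
    refine Finset.sum_congr rfl fun n _ => ?_
    have h0 := τ.energy_nonneg lam n
    rcases le_total 1 (τ.energy lam n) with h | h
    · rw [min_eq_left h, min_eq_left (Real.one_le_sqrt.2 h), one_pow]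
    · rw [min_eq_right h, min_eq_right (Real.sqrt_le_one.2 h), Real.sq_sqrt h0]
  have hcard : (τ.N.card : ℝ) ≤ T := by
    have := Finset.card_le_card hN
    rw [Nat.card_Icc, Nat.add_sub_cancel] at this
    exact_mod_cast this
  have h4 : 0 ≤ ∑ n ∈ τ.N, min 1 (τ.energy lam n) :=
    Finset.sum_nonneg fun n _ => le_min zero_le_one (τ.energy_nonneg lam n)
  calc _ ≤ (τ.N.card : ℝ) * ∑ n ∈ τ.N, (min 1 √(τ.energy lam n)) ^ 2 := sq_sum_le_card_mul_sum_sq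
    _ ≤ T * (2 * (d * Real.log (1 + (T : ℝ) * K / d))) := by
        rw [h3]
        exact mul_le_mul hcard (by linarith) h4 (by positivity)

lemma H_le (hN : τ.N ⊆ Icc 1 T) (hlam : 0 < lam) (hd : 1 ≤ d)
    (hx : ∀ t ∈ Icc 1 T, ∀ e, ‖τ.x t e‖ ^ 2 ≤ lam) (hA : ∀ t ∈ Icc 1 T, (τ.A t).card ≤ K)
    {S δ : ℝ} (hδ : 0 < δ) (t : ℕ) :
    τ.H lam S δ t ≤ √lam * S + √(d * Real.log (1 + (T : ℝ) * K / d) + 2 * Real.log (1 / δ)) := by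
  have h := log_det_le hN hlam hd hx hA t
  have hdet := (posDef_V hN hlam t).det_pos
  unfold H
  gcongr
  rw [← div_div, Real.log_div (by positivity) (by positivity), Real.log_pow, one_div, Real.log_inv]
  push_cast
  linarith

/-! ### Regret on the confidence event -/

section Regret

variable {f : Finset (Arm M m₀) → (Arm M m₀ → ℝ) → ℝ} {α μ₀ L S δ P Δmin Δmax : ℝ}
  {θ : EuclideanSpace ℝ (Fin d)} {η : ℝ}

lemma abs_thetaHat_sub_meanWeight_le {t : ℕ} (hη : τ.H lam S δ t ≤ η)
    (hconf : ∀ y : Fin d → ℝ, |τ.thetaHat lam t ⬝ᵥ y - θ.ofLp ⬝ᵥ y|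
        ≤ τ.H lam S δ t * √(y ⬝ᵥ (τ.V lam t)⁻¹ *ᵥ y)) (s : ℕ) (e : Arm M m₀) :
    |τ.thetaHat lam t ⬝ᵥ (τ.x s e).ofLp - meanWeight θ (τ.x s) e|
        ≤ τ.H lam S δ t * τ.width lam t s e ∧
      τ.H lam S δ t * τ.width lam t s e ≤ η * τ.width lam t s e := by
  refine ⟨?_, mul_le_mul_of_nonneg_right hη (Real.sqrt_nonneg _)⟩
  have := hconf (τ.x s e).ofLp
  rwa [show meanWeight θ (τ.x s) e = θ.ofLp ⬝ᵥ (τ.x s e).ofLp by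
    rw [meanWeight, EuclideanSpace.inner_eq_star_dotProduct, dotProduct_comm]; simp]

/-- The optimal value exceeds the value of the action played in an optimistic round by at most a
multiple of the width of that action. -/
lemma bestValue_le_add (hf : IsReward K P f) (hrun : τ.IsRun K T f α μ₀ lam S δ)
    (hadm : IsAdmissible τ K T f θ μ₀ L Δmin Δmax) (hη₀ : 0 ≤ η)
    (hη : ∀ t ≤ T, τ.H lam S δ t ≤ η)
    (hconf : ∀ t ≤ T, ∀ y : Fin d → ℝ, |τ.thetaHat lam t ⬝ᵥ y - θ.ofLp ⬝ᵥ y|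
        ≤ τ.H lam S δ t * √(y ⬝ᵥ (τ.V lam t)⁻¹ *ᵥ y)) {n : ℕ} (hn : n ∈ τ.N) :
    bestValue K f (meanWeight θ (τ.x n))
      ≤ f (τ.A n) (meanWeight θ (τ.x n)) + 2 * |P| * η * √(τ.energy lam n) := by
  have hnT := hrun.opt_subset hn
  have hn1 : n - 1 ≤ T := (Nat.sub_le _ _).trans (Finset.mem_Icc.1 hnT).2
  have hcons := hadm.conservative_reward n hnT
  have hb := fun e => abs_thetaHat_sub_meanWeight_le (hη _ hn1) (hconf _ hn1) n e
  have hopt : ∀ A ∈ alternatives M m₀ K,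
      f A (meanWeight θ (τ.x n)) ≤ f A (τ.U lam S δ n n) := fun A hA =>
    hf.mono A (Finset.mem_insert_of_mem hA) _ _ fun e _ => by
      have := (abs_le.1 (hb e).1).1
      rw [U]; linarith
  have hs : 0 ≤ 2 * |P| * η * √(τ.energy lam n) := by positivity
  rw [hrun.play_opt n hnT hn]
  -- If the candidate is conservative, every alternative is optimistically below `μ₀`, so the
  -- conservative action is truly optimal and there is no regret.
  by_cases hc : ∀ A ∈ alternatives M m₀ K, f A (τ.U lam S δ n n) < μ₀
  · rw [hrun.candidate_conservative n hnT hc, hcons]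
    refine Finset.sup'_le _ _ fun A hA => ?_
    rcases Finset.mem_insert.1 hA with rfl | hA
    · linarith
    · linarith [hopt A hA, hc A hA]
  · obtain ⟨hB, hmax⟩ := hrun.candidate_alternative n hnT hc
    have h1 : f (τ.B n) (τ.U lam S δ n n) ≤ f (τ.B n) (meanWeight θ (τ.x n))
        + |P| * (2 * η) * √(∑ e ∈ τ.B n, τ.width lam (n - 1) n e ^ 2) :=
      hf.le_add (Finset.mem_insert_of_mem hB) (by linarith) fun e _ => by
        have := (abs_le.1 (hb e).1).2
        have := (hb e).2
        rw [U]; linarith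
    have h2 : τ.energy lam n = ∑ e ∈ τ.B n, τ.width lam (n - 1) n e ^ 2 := by
      rw [energy, hrun.play_opt n hnT hn]
    rw [← h2] at h1
    refine Finset.sup'_le _ _ fun A hA => ?_
    rcases Finset.mem_insert.1 hA with rfl | hA
    -- To compare with the conservative action, use an alternative whose optimistic value reaches
    -- `μ₀`; the maximizer does at least as well.
    · push Not at hc
      obtain ⟨A', hA', h3⟩ := hc
      linarith [hmax A' hA']
    · linarith [hopt A hA, hmax A hA]

/-- Widths shrink as data accumulate, so the width at the time of play controls every later lower
bound; truncation at zero only raises that bound. -/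
lemma value_le_lower_add (hf : IsReward K P f) (hrun : τ.IsRun K T f α μ₀ lam S δ)
    (hlam : 0 < lam) (hη₀ : 0 ≤ η) (hη : ∀ t ≤ T, τ.H lam S δ t ≤ η)
    (hconf : ∀ t ≤ T, ∀ y : Fin d → ℝ, |τ.thetaHat lam t ⬝ᵥ y - θ.ofLp ⬝ᵥ y|
        ≤ τ.H lam S δ t * √(y ⬝ᵥ (τ.V lam t)⁻¹ *ᵥ y)) {n t : ℕ} (hn : n ∈ τ.N) (hnt : n ≤ t)
    (ht : t ≤ T) :
    f (τ.A n) (meanWeight θ (τ.x n))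
      ≤ f (τ.A n) (τ.Lo lam S δ t n) + 2 * |P| * η * √(τ.energy lam n) := by
  have hnT := hrun.opt_subset hn
  have ht1 : t - 1 ≤ T := (Nat.sub_le _ _).trans ht
  have h := hf.le_add (hrun.played_mem hnT) (w := meanWeight θ (τ.x n))
    (v := τ.Lo lam S δ t n) (a := τ.width lam (n - 1) n) (b := 2 * η) (by linarith) fun e _ => by
      have hb := abs_thetaHat_sub_meanWeight_le (hη _ ht1) (hconf _ ht1) n e
      have h1 := (abs_le.1 hb.1).1
      have h2 := mul_le_mul_of_nonneg_left
        (width_antitone hrun.opt_subset hlam (Nat.sub_le_sub_right hnt 1) n e) hη₀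
      have h3 := le_max_right 0 (τ.thetaHat lam (t - 1) ⬝ᵥ (τ.x n e).ofLp
        - τ.H lam S δ (t - 1) * τ.width lam (t - 1) n e)
      rw [Lo]
      linarith [hb.2]
  rw [← energy] at h
  linarith

lemma conservative_value_le_bestValue
    (hadm : IsAdmissible τ K T f θ μ₀ L Δmin Δmax) {t : ℕ} (ht : t ∈ Icc 1 T) :
    μ₀ ≤ bestValue K f (meanWeight θ (τ.x t)) := by
  rw [← hadm.conservative_reward t ht]
  exact Finset.le_sup' (fun A => f A (meanWeight θ (τ.x t))) (Finset.mem_insert_self _ _)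

/-- A round in which the conservative branch is taken cannot come late. -/
lemma conservative_round_le (hf : IsReward K P f) (hrun : τ.IsRun K T f α μ₀ lam S δ)
    (hadm : IsAdmissible τ K T f θ μ₀ L Δmin Δmax) (hlam : 0 < lam) (hμ₀ : 0 < μ₀) (hη₀ : 0 ≤ η)
    (hη : ∀ t ≤ T, τ.H lam S δ t ≤ η)
    (hconf : ∀ t ≤ T, ∀ y : Fin d → ℝ, |τ.thetaHat lam t ⬝ᵥ y - θ.ofLp ⬝ᵥ y|
        ≤ τ.H lam S δ t * √(y ⬝ᵥ (τ.V lam t)⁻¹ *ᵥ y)) {C : ℝ} (hC : 4 * |P| * η + μ₀ ≤ C)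
    {t : ℕ} (ht : t ∈ Icc 1 T) (htN : t ∉ τ.N) :
    α * μ₀ * t ≤ μ₀ + C * ∑ n ∈ τ.N, min 1 √(τ.energy lam n) := by
  have ht' := Finset.mem_Icc.1 ht
  -- The `4` is `2` for optimism plus `2` for the lower bound. When the width exceeds one,
  -- nonnegativity of the credited reward and `μ₀ ≤ C` suffice.
  have hlow : ∀ n ∈ τ.optRounds (t - 1),
      μ₀ - C * min 1 √(τ.energy lam n) ≤ f (τ.A n) (τ.Lo lam S δ t n) := by
    intro n hn
    obtain ⟨hnN, hnt⟩ := Finset.mem_filter.1 hn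
    have hnT := hrun.opt_subset hnN
    have hP : 0 ≤ 4 * |P| * η := by positivity
    rcases le_total 1 √(τ.energy lam n) with h | h
    · rw [min_eq_left h]
      have := hf.nonneg _ (hrun.played_mem hnT) (τ.Lo lam S δ t n) fun e _ => le_max_left _ _
      linarith
    · rw [min_eq_right h]
      have h1 := bestValue_le_add hf hrun hadm hη₀ hη hconf hnN
      have h2 := value_le_lower_add hf hrun hlam hη₀ hη hconf hnN (by omega) ht'.2
      have h3 := conservative_value_le_bestValue hadm hnT
      have h4 := mul_le_mul_of_nonneg_right (show 4 * |P| * η ≤ C by linarith)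
        (Real.sqrt_nonneg (τ.energy lam n))
      linarith
  -- The candidate is credited with nothing; this costs one `μ₀`, matching the `+ 1` in the count of
  -- rounds below.
  have hcand : 0 ≤ τ.candidateLower f μ₀ lam S δ t := by
    unfold candidateLower
    split_ifs
    · exact hμ₀.le
    · exact hf.nonneg _ (hrun.candidate_mem ht) _ fun e _ => le_max_left _ _
  have hpsi := not_le.1 (fun h => htN ((hrun.opt_iff t ht).2 h))
  have hsum := Finset.sum_le_sum hlow
  rw [Finset.sum_sub_distrib, Finset.sum_const, nsmul_eq_mul, ← Finset.mul_sum] at hsum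
  have hC0 : 0 ≤ C := le_trans (by positivity) hC
  have hmono : ∑ n ∈ τ.optRounds (t - 1), min 1 √(τ.energy lam n)
      ≤ ∑ n ∈ τ.N, min 1 √(τ.energy lam n) :=
    Finset.sum_le_sum_of_subset_of_nonneg (Finset.filter_subset _ _)
      fun _ _ _ => le_min zero_le_one (Real.sqrt_nonneg _)
  have hmono' := mul_le_mul_of_nonneg_left hmono hC0
  have hcount : ((τ.optRounds (t - 1)).card : ℝ) + ((τ.consRounds (t - 1)).card : ℝ) + 1 = t := by
    have h1 : τ.consRounds (t - 1) = Icc 1 (t - 1) \ τ.optRounds (t - 1) := by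
      ext n
      simp only [consRounds, optRounds, Finset.mem_sdiff, Finset.mem_filter, Finset.mem_Icc]
      tauto
    have h2 : τ.optRounds (t - 1) ⊆ Icc 1 (t - 1) := fun n hn => by
      obtain ⟨hnN, hnt⟩ := Finset.mem_filter.1 hn
      exact Finset.mem_Icc.2 ⟨(Finset.mem_Icc.1 (hrun.opt_subset hnN)).1, hnt⟩
    have h3 := Finset.card_sdiff_add_card_eq_card h2
    rw [← h1, Nat.card_Icc] at h3
    have : (τ.optRounds (t - 1)).card + (τ.consRounds (t - 1)).card + 1 = t := by omega
    exact_mod_cast this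
  rw [psi] at hpsi
  have hcount' : ((τ.optRounds (t - 1)).card : ℝ) * μ₀ + ((τ.consRounds (t - 1)).card : ℝ) * μ₀
      = t * μ₀ - μ₀ := by linear_combination μ₀ * hcount
  linarith

/-- Optimistic rounds cost at most `C min 1 √g_n`. The conservative ones cost at most `|Δmax|` each,
and their number is controlled by the same sum. -/
lemma regret_le (hf : IsReward K P f) (hrun : τ.IsRun K T f α μ₀ lam S δ)
    (hadm : IsAdmissible τ K T f θ μ₀ L Δmin Δmax) (hlam : 0 < lam) (hα : 0 < α) (hμ₀ : 0 < μ₀)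
    (hη₀ : 0 ≤ η) (hη : ∀ t ≤ T, τ.H lam S δ t ≤ η)
    (hconf : ∀ t ≤ T, ∀ y : Fin d → ℝ, |τ.thetaHat lam t ⬝ᵥ y - θ.ofLp ⬝ᵥ y|
        ≤ τ.H lam S δ t * √(y ⬝ᵥ (τ.V lam t)⁻¹ *ᵥ y)) {C : ℝ}
    (hC : 4 * |P| * η + μ₀ + |Δmax| ≤ C) :
    τ.regret K T f θ ≤ C * (1 + |Δmax| / (α * μ₀)) * ∑ n ∈ τ.N, min 1 √(τ.energy lam n)
      + |Δmax| / α := by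
  set Q := ∑ n ∈ τ.N, min 1 √(τ.energy lam n)
  have hP : 0 ≤ |P| * η := by positivity
  have hΔ := abs_nonneg Δmax
  have hround : ∀ t ∈ Icc 1 T, bestValue K f (meanWeight θ (τ.x t))
      - f (τ.A t) (meanWeight θ (τ.x t))
        ≤ if t ∈ τ.N then C * min 1 √(τ.energy lam t) else |Δmax| := by
    intro t ht
    have h1 := hadm.gap_upper t ht
    have h2 := hadm.reward_nonneg t ht _ (hrun.played_mem ht)
    have h3 := le_abs_self Δmax
    split_ifs with hN
    · rcases le_total 1 √(τ.energy lam t) with h | h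
      · rw [min_eq_left h]
        linarith
      · rw [min_eq_right h]
        have h4 := bestValue_le_add hf hrun hadm hη₀ hη hconf hN
        have h5 := mul_le_mul_of_nonneg_right (show 2 * |P| * η ≤ C by linarith)
          (Real.sqrt_nonneg (τ.energy lam t))
        linarith
    · rw [hrun.play_cons t ht hN, hadm.conservative_reward t ht]
      linarith
  have hsum := Finset.sum_le_sum hround
  rw [Finset.sum_ite, ← Finset.mul_sum, Finset.sum_const, nsmul_eq_mul] at hsum
  have hfil : (Icc 1 T).filter (· ∈ τ.N) = τ.N := by
    rw [Finset.filter_mem_eq_inter, Finset.inter_eq_right.2 hrun.opt_subset]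
  rw [hfil] at hsum
  have hcard : α * μ₀ * (((Icc 1 T).filter (· ∉ τ.N)).card : ℝ) ≤ μ₀ + C * Q := by
    set D := (Icc 1 T).filter (· ∉ τ.N) with hD
    have hC0 : 0 ≤ C := by linarith
    have hQ : 0 ≤ Q := Finset.sum_nonneg fun _ _ => le_min zero_le_one (Real.sqrt_nonneg _)
    rcases D.eq_empty_or_nonempty with h | h
    · rw [h]
      simp only [Finset.card_empty, Nat.cast_zero, mul_zero]
      positivity
    -- The number of conservative rounds is at most the index of the last one.
    · have hmem := Finset.max'_mem D h
      obtain ⟨h1, h2⟩ := Finset.mem_filter.1 hmem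
      have h3 : D ⊆ Icc 1 (D.max' h) := fun n hn => Finset.mem_Icc.2
        ⟨(Finset.mem_Icc.1 (Finset.mem_filter.1 hn).1).1, Finset.le_max' D n hn⟩
      have h4 := Finset.card_le_card h3
      rw [Nat.card_Icc, Nat.add_sub_cancel] at h4
      have h5 : (D.card : ℝ) ≤ D.max' h := by exact_mod_cast h4
      exact (mul_le_mul_of_nonneg_left h5 (by positivity)).trans
        (conservative_round_le hf hrun hadm hlam hμ₀ hη₀ hη hconf (by linarith) h1 h2)
  have hcard' : (((Icc 1 T).filter (· ∉ τ.N)).card : ℝ) ≤ (μ₀ + C * Q) / (α * μ₀) := by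
    rw [le_div_iff₀ (by positivity)]
    linarith
  have hfinal := mul_le_mul_of_nonneg_right hcard' hΔ
  rw [regret]
  refine hsum.trans ?_
  have hid : C * (1 + |Δmax| / (α * μ₀)) * Q + |Δmax| / α
      = C * Q + (μ₀ + C * Q) / (α * μ₀) * |Δmax| := by
    field_simp
    ring
  rw [hid]
  linarith

end Regret

end Trajectory

/-! ### Explicit constants and the final bound -/

lemma log_one_add_le_two_mul_max {x : ℝ} (hx : 0 ≤ x) :
    Real.log (1 + x) ≤ 2 * max 1 (Real.log x) := by
  have h2 : Real.log 2 ≤ 1 := by linarith [Real.log_two_lt_d9]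
  have hm := le_max_left 1 (Real.log x)
  rcases le_total x 1 with h | h
  · have := Real.log_le_log (by linarith) (show 1 + x ≤ 2 by linarith)
    linarith
  · have := Real.log_le_log (by linarith) (show 1 + x ≤ 2 * x by linarith)
    rw [Real.log_mul (by norm_num) (by linarith)] at this
    linarith [le_max_right 1 (Real.log x)]

/-- The regret of a run along which all confidence ellipsoids are valid. -/
lemma Trajectory.regret_le_of_confidence {d M m₀ K T : ℕ} {τ : Trajectory d M m₀}
    {f : Finset (Arm M m₀) → (Arm M m₀ → ℝ) → ℝ} {α μ₀ lam L S δ P Δmin Δmax : ℝ}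
    {θ : EuclideanSpace ℝ (Fin d)} (hf : IsReward K P f) (hrun : τ.IsRun K T f α μ₀ lam S δ)
    (hadm : IsAdmissible τ K T f θ μ₀ L Δmin Δmax) (hlam : 0 < lam) (hL : L ≤ lam) (hα : 0 < α)
    (hμ₀ : 0 < μ₀) (hδ₀ : 0 < δ) (hδ₁ : δ < 1) (hd : 1 ≤ d) (hT : 1 ≤ T) (hm₀ : m₀ ≤ K)
    (hconf : ∀ t ≤ T, ∀ y : Fin d → ℝ, |τ.thetaHat lam t ⬝ᵥ y - θ.ofLp ⬝ᵥ y|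
        ≤ τ.H lam S δ t * √(y ⬝ᵥ (τ.V lam t)⁻¹ *ᵥ y)) :
    τ.regret K T f θ
      ≤ (2 * (4 * |P| * (√lam * |S| + √(2 + 2 * Real.log (1 / δ))) + μ₀ + |Δmax|)
          * (1 + |Δmax| / (α * μ₀)) + |Δmax| / α)
        * (d * √T * max 1 (Real.log ((T : ℝ) * K / d))) := by
  set m := max 1 (Real.log ((T : ℝ) * K / d))
  have hm : 1 ≤ m := le_max_left _ _
  have hd1 : (1 : ℝ) ≤ d := by exact_mod_cast hd
  have hT1 : (1 : ℝ) ≤ T := by exact_mod_cast hT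
  -- This lets every constant be absorbed into a multiple of `√(d m)`, both in the radius and in
  -- `C`.
  have hdm : 1 ≤ d * m := one_le_mul_of_one_le_of_one_le hd1 hm
  have hq : 1 ≤ √(d * m) := Real.one_le_sqrt.2 hdm
  have hqq : √(d * m) * √(d * m) = d * m := Real.mul_self_sqrt (by linarith)
  have hlog : Real.log (1 + (T : ℝ) * K / d) ≤ 2 * m := log_one_add_le_two_mul_max (by positivity)
  have hlogδ : 0 ≤ Real.log (1 / δ) := Real.log_nonneg (by rw [le_div_iff₀ hδ₀]; linarith)
  set h := √lam * |S| + √(2 + 2 * Real.log (1 / δ))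
  have hh : 0 ≤ h := by positivity
  have hx : ∀ t ∈ Icc 1 T, ∀ e, ‖τ.x t e‖ ^ 2 ≤ lam := fun t ht e =>
    (hadm.feature_bound t ht e).trans hL
  have hA : ∀ t ∈ Icc 1 T, (τ.A t).card ≤ K := fun t ht =>
    card_le_of_mem_feasible hm₀ (hrun.played_mem ht)
  have hdlog : d * Real.log (1 + (T : ℝ) * K / d) ≤ 2 * (d * m) := by
    have := mul_le_mul_of_nonneg_left hlog (show (0 : ℝ) ≤ d by positivity)
    linarith
  have hη : ∀ t ≤ T, τ.H lam S δ t ≤ h * √(d * m) := by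
    intro t _
    refine (H_le hrun.opt_subset hlam hd hx hA hδ₀ t).trans ?_
    have h1 : √(d * Real.log (1 + (T : ℝ) * K / d) + 2 * Real.log (1 / δ))
        ≤ √(2 + 2 * Real.log (1 / δ)) * √(d * m) := by
      rw [← Real.sqrt_mul (by positivity)]
      refine Real.sqrt_le_sqrt ?_
      have := mul_le_mul_of_nonneg_left hdm hlogδ
      linarith
    have h2 : √lam * S ≤ √lam * |S| * √(d * m) :=
      (mul_le_mul_of_nonneg_left (le_abs_self S) (Real.sqrt_nonneg _)).trans
        (le_mul_of_one_le_right (by positivity) hq)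
    calc _ ≤ √lam * |S| * √(d * m) + √(2 + 2 * Real.log (1 / δ)) * √(d * m) := add_le_add h2 h1
      _ = h * √(d * m) := by ring
  set C₀ := 4 * |P| * h + μ₀ + |Δmax|
  have hC₀ : 0 ≤ C₀ := by positivity
  have hreg := regret_le hf hrun hadm hlam hα hμ₀ (by positivity) hη hconf
    (C := C₀ * √(d * m)) (by
      have := mul_le_mul_of_nonneg_left hq (show 0 ≤ μ₀ + |Δmax| by positivity)
      calc _ = 4 * |P| * h * √(d * m) + (μ₀ + |Δmax|) * 1 := by ring
        _ ≤ 4 * |P| * h * √(d * m) + (μ₀ + |Δmax|) * √(d * m) := by linarith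
        _ = C₀ * √(d * m) := by ring)
  have hsum : ∑ n ∈ τ.N, min 1 √(τ.energy lam n) ≤ 2 * √T * √(d * m) := by
    refine (sum_min_sqrt_energy_le hrun.opt_subset hlam hd hx hA).trans ?_
    have : 2 * √T * √(d * m) = √(T * (2 * (2 * (d * m)))) := by
      rw [show (T : ℝ) * (2 * (2 * (d * m))) = 2 ^ 2 * T * (d * m) by ring,
        Real.sqrt_mul (show (0 : ℝ) ≤ 2 ^ 2 * T by positivity),
        Real.sqrt_mul (show (0 : ℝ) ≤ 2 ^ 2 by positivity),
        Real.sqrt_sq (show (0 : ℝ) ≤ 2 by norm_num)]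
    rw [this]
    gcongr
  -- Used to absorb the additive term `|Δmax| / α`.
  have hone : 1 ≤ d * √T * m := by
    have : 1 ≤ √(T : ℝ) := Real.one_le_sqrt.2 hT1
    calc (1 : ℝ) ≤ (d * m) * √T := one_le_mul_of_one_le_of_one_le hdm this
      _ = d * √T * m := by ring
  calc τ.regret K T f θ
      ≤ C₀ * √(d * m) * (1 + |Δmax| / (α * μ₀)) * (2 * √T * √(d * m)) + |Δmax| / α :=
        hreg.trans (by gcongr)
    _ = 2 * C₀ * (1 + |Δmax| / (α * μ₀)) * √T * (√(d * m) * √(d * m)) + |Δmax| / α * 1 := by ring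
    _ ≤ 2 * C₀ * (1 + |Δmax| / (α * μ₀)) * √T * (d * m) + |Δmax| / α * (d * √T * m) := by
        rw [hqq]; gcongr
    _ = _ := by ring

end CCB

theorem theorem1 (α μ₀ lam L S P δ Δmin Δmax : ℝ)
    (hα₀ : 0 < α) (hα₁ : α < 1) (hμ₀ : 0 < μ₀) (hlam : 0 < lam) (hL : L ≤ lam)
    (hδ₀ : 0 < δ) (hδ₁ : δ < 1) (hgap : 0 < α * μ₀ + Δmin) :
    ∃ c : ℝ, 0 < c ∧
      ∀ (d M m₀ K T : ℕ), 1 ≤ d → 1 ≤ K → 1 ≤ T → m₀ ≤ K →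
      ∀ (f : Finset (CCB.Arm M m₀) → (CCB.Arm M m₀ → ℝ) → ℝ), CCB.IsReward K P f →
      ∀ (θ : EuclideanSpace ℝ (Fin d)), ‖θ‖ ≤ S →
      ∀ (Ω : Type u) [MeasurableSpace Ω] (ℙ : Measure Ω) [IsProbabilityMeasure ℙ]
        (ℱ : Filtration ℕ ‹MeasurableSpace Ω›) (τ : Ω → CCB.Trajectory d M m₀),
        CCB.IsStochasticModel ℙ ℱ T θ τ →
        (∀ ω, CCB.IsAdmissible (τ ω) K T f θ μ₀ L Δmin Δmax) →
        (∀ ω, (τ ω).IsRun K T f α μ₀ lam S δ) →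
        ENNReal.ofReal (1 - δ) ≤
          ℙ {ω |
            (τ ω).regret K T f θ ≤
              c * ((d : ℝ) * (d + Real.sqrt T) * max 1 (Real.log ((T : ℝ) * K / d))
                + (d : ℝ) / K) ∧
            (T * K ≤ d →
              (τ ω).regret K T f θ ≤
                c * ((d : ℝ) * Real.sqrt T + (d : ℝ) ^ (3 / 2 : ℝ) / Real.sqrt K))} := by
  have hlogδ : 0 ≤ Real.log (1 / δ) := Real.log_nonneg (by rw [le_div_iff₀ hδ₀]; linarith)
  -- The constant is fixed before the instance, when no signs of `P`, `S` and `Δmax` are available;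
  -- absolute values keep it positive.
  refine ⟨2 * (4 * |P| * (√lam * |S| + √(2 + 2 * Real.log (1 / δ))) + μ₀ + |Δmax|)
          * (1 + |Δmax| / (α * μ₀)) + |Δmax| / α, by positivity, ?_⟩
  intro d M m₀ K T hd hK hT hm₀ f hf θ hθ Ω _ ℙ _ ℱ τ hmod hadm hrun
  refine (CCB.Trajectory.le_measure_confidence hf hmod hrun hlam hδ₀ hθ).trans
    (measure_mono fun ω hω => ?_)
  have hreg := CCB.Trajectory.regret_le_of_confidence hf (hrun ω) (hadm ω) hlam hL hα₀ hμ₀ hδ₀ hδ₁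
    hd hT hm₀ hω
  have hc : 0 ≤ 2 * (4 * |P| * (√lam * |S| + √(2 + 2 * Real.log (1 / δ))) + μ₀ + |Δmax|)
          * (1 + |Δmax| / (α * μ₀)) + |Δmax| / α := by positivity
  refine ⟨hreg.trans (mul_le_mul_of_nonneg_left ?_ hc), fun hTK =>
    hreg.trans (mul_le_mul_of_nonneg_left ?_ hc)⟩
  · have hm : 0 ≤ max 1 (Real.log ((T : ℝ) * K / d)) := zero_le_one.trans (le_max_left _ _)
    have h1 : (0 : ℝ) ≤ d * d * max 1 (Real.log ((T : ℝ) * K / d)) := by positivity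
    have h2 : (0 : ℝ) ≤ d / K := by positivity
    linarith
  -- When `T K ≤ d` the logarithm is nonpositive, so the maximum is `1` and `d √T` alone suffices.
  · have hlog : Real.log ((T : ℝ) * K / d) ≤ 1 := by
      have h1 : (T : ℝ) * K / d ≤ 1 := by
        rw [div_le_one (by exact_mod_cast hd)]
        exact_mod_cast hTK
      exact (Real.log_nonpos (by positivity) h1).trans zero_le_one
    rw [max_eq_left hlog, mul_one]
    have : 0 ≤ (d : ℝ) ^ (3 / 2 : ℝ) / Real.sqrt K := by positivity
    linarith
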